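/- Let $\mathcal H_1=\mathbb C[t_1,t_2,t_4]$ be the Hopf subalgebra of the Connes--Kreimer Hopf algebra of rooted trees generated by the one-vertex tree $t_1$, the two-vertex tree $t_2$ and the cherry $t_4$ (a root with two leaves), of degrees $1,2,3$; thus $\Delta t_1=t_1\otimes1+1\otimes t_1$, $\Delta t_2=t_2\otimes 1+1\otimes t_2+t_1\otimes t_1$, $\Delta t_4=t_4\otimes1+1\otimes t_4+2\,t_1\otimes t_2+t_1^2\otimes t_1$. For a commutative $\mathbb C$-algebra $A$ let $G_A$ be the group of $A$-valued characters of $\mathcal H_1$ under convolution $\star$, and $\mathfrak g_A$ the Lie algebra of $A$-valued infinitesimal characters, with $[Z,W]=Z\star W-W\star Z$. Put $\mathcal A=\mathbb C[\lambda^{-1},\lambda]]$ and $\mathfrak g_1=\mathfrak g_{\mathbb C}$. Let $X_1,X_2,X_3\in\mathfrak g_1$ be the infinitesimal characters dual to $t_1,t_2,t_4$. *The flow.* For $\varphi\in G_{\mathcal A}$ and $s\in\mathbb C$ let $\varphi^s(x)=e^{s\lambda|x|}\varphi(x)$ for homogeneous $x$ of degree $|x|$; let $\tilde R(\varphi)=\varphi^{-1}\star(\varphi\circ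 Y)$, with $Y$ the degree derivation, and $\tilde\beta_\varphi=\frac{d}{ds}\big|_{s=0}\varphi^{-1}\star\varphi^s$. The character $\varphi$ is local if $\frac{d}{ds}(\varphi^s)_-=0$, where $\psi=\psi_-^{-1}\star\psi_+$ is the Birkhoff factorization for minimal subtraction. Let $n,m\in\mathbb Z$ with $-n+2m\le0$, put $p=n-2m+1$, let $\varphi$ be local, and let $L(t)$, $t\in\mathbb R$, be the solution of $\frac{dL}{dt}=[L,R(\lambda^{-n+2m}L)]$, $L(0)=\tilde R(\varphi)$, where $R=P_+-P_-$, with $P_-$ the polar part and $P_+=\mathrm{id}-P_-$. Let $\tilde R(\varphi_t)=L(t)$, and let $\tilde\beta_k(t)\in\mathfrak g_1$ be the coefficient of $\lambda^k$ in $\tilde\beta_{\varphi_t}$. *The double.* Let $\delta_1=\mathfrak g_1\oplus\mathfrak g_1^*$ with $[X+\xi,Y+\eta]=[X,Y]+\mathrm{ad}^*_X\eta-\mathrm{ad}^*_Y\xi$, where $(\mathrm{ad}^*_X\eta)(Z)=-\eta([X,Z])$, and with the natural pairing $\langle X+\xi,Y+\eta\rangle=\xi(Y)+\eta(X)$. Write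 $x=\sum x_iX_i+\sum x_i^*X_i^*$. For polynomials $f,g$ on $\delta_1$ let $\nabla f=\sum\frac{\partial f}{\partial x_i}X_i+\sum\frac{\partial f}{\partial x_i^*}X_i^*$ be the coordinate gradient and $\nabla^{\langle\rangle}f=\sum\frac{\partial f}{\partial x_i^*}X_i+\sum\frac{\partial f}{\partial x_i}X_i^*$ the gradient with respect to the pairing. Consider two brackets: $\{f,g\}(x)=\langle x,[\nabla f,\nabla g]\rangle$, that is, $\{x_1,x_2\}=2x_3^*$, $\{x_1,x_3^*\}=-2x_2$, $\{x_2,x_3^*\}=2x_1$, the other brackets of coordinates being zero up to antisymmetry; and $\{f,g\}_{LP}(x)=\langle x,[\nabla^{\langle\rangle}f,\nabla^{\langle\rangle}g]\rangle$, the Lie--Poisson bracket of $\delta_1^*$ carried to $\delta_1$ by the pairing. **Theorem.** 1. $X_1,X_2,X_3$ is a basis of $\mathfrak g_1$, with $[X_1,X_2]=2X_3$ and $X_3$ central (Heisenberg algebra). Both $\{\cdot,\cdot\}$ and $\{\cdot,\cdot\}_{LP}$ are Poisson brackets on $\delta_1$, of rank (maximal rank of the Poisson tensor) $2$. 2. $\frac{d\tilde\beta_0}{dt}=2[\tilde\beta_0,\tilde\beta_p]$,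 and $\tilde\beta_0(t)$ and $\tilde\beta_p(t)$ are affine in $t$. 3. For every such flow there are constants $k_i,l_i\in\mathbb C$ $(i=1,2,3)$ such that, with $H(x)=\sum_{i=1}^3\left(k_ix_i+\tfrac12l_ix_i^2\right)$: (a) $\frac{d\tilde\beta_0}{dt}=2[\tilde\beta_0,\nabla H(\tilde\beta_0)]$ for all $t$; moreover $\tilde\beta_p(t)=\nabla H(\tilde\beta_0(t))$ for all $t$, unless $\tilde\beta_0$ is constant and $\tilde\beta_p$ is not; (b) $H$, $H_2=\frac{x_3^2}2$, $H_3=\frac{x_1^{*2}}2$, $H_4=\frac{x_2^{*2}}2$, $H_5=\frac{x_3^{*2}+x_1^2+x_2^2}2$ are in involution for $\{\cdot,\cdot\}$, and their differentials are linearly independent on an open dense subset of $\delta_1$; (c) the flow is completely integrable for the Lie--Poisson bracket $\{\cdot,\cdot\}_{LP}$ with these same constants: with $\hat H(x)=\sum_{i=1}^3(k_i+l_ix_i)x_i^*$, the curve $\tilde\beta_0(t)$ is an integral curve of the Hamiltonian vector field of $-2\hat H$, i.e. $\frac{d}{dt}f(\tilde\beta_0(t))=\{f,-2\hat H\}_{LP}(\tilde\beta_0(t))$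 for every polynomial $f$ on $\delta_1$, and the five functions $\hat H,\ x_1,\ x_2,\ x_3^*,\ x_1x_1^*+x_2x_2^*+x_3x_3^*$ are in involution for $\{\cdot,\cdot\}_{LP}$, with differentials linearly independent on an open dense subset of $\delta_1$. -/

import Mathlib

open scoped TensorProduct
open WithConv

noncomputable section

namespace RootedTreeFlow

/-! ## The Hopf algebra of rooted trees generated by the one-vertex tree, the two-vertex tree and
the cherry -/

/-- Three rooted trees: `t1` is the one-vertex tree, `t2` is the tree with two vertices, `t4` is
the cherry (a root with two leaves). -/
inductive RTree
  | t1
  | t2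
  | t4
  deriving DecidableEq

namespace RTree

instance instFintype : Fintype RTree := ⟨{t1, t2, t4}, fun x => by cases x <;> simp⟩

/-- The degree of a tree is its number of vertices. -/
def deg : RTree → ℕ
  | t1 => 1
  | t2 => 2
  | t4 => 3

end RTree

open RTree

/-- The subalgebra of the Connes-Kreimer algebra of rooted trees generated by the three trees.
The Connes-Kreimer algebra is the polynomial algebra on all rooted trees, so this is the
polynomial algebra on the three trees. -/
def H1 : Type := MvPolynomial RTree ℂ

instance instCommRingH1 : CommRing H1 := inferInstanceAs (CommRing (MvPolynomial RTree ℂ))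

instance instAlgebraH1 : Algebra ℂ H1 := inferInstanceAs (Algebra ℂ (MvPolynomial RTree ℂ))

/-- The tree `i` as an element of `H1`. -/
def tree (i : RTree) : H1 := (MvPolynomial.X i : MvPolynomial RTree ℂ)

/-- The algebra map from `H1` with given values on the trees. -/
def lift {B : Type} [CommRing B] [Algebra ℂ B] (f : RTree → B) : H1 →ₐ[ℂ] B :=
  (MvPolynomial.aeval f : MvPolynomial RTree ℂ →ₐ[ℂ] B)

@[simp]
theorem lift_tree {B : Type} [CommRing B] [Algebra ℂ B] (f : RTree → B) (i : RTree) :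
    lift f (tree i) = f i := MvPolynomial.aeval_X f i

theorem algHom_ext_H1 {B : Type} [CommRing B] [Algebra ℂ B] {f g : H1 →ₐ[ℂ] B}
    (h : ∀ i, f (tree i) = g (tree i)) : f = g :=
  MvPolynomial.algHom_ext (A := B) (f := f) (g := g) h

/-- The Connes-Kreimer coproduct `Δ T = T ⊗ 1 + 1 ⊗ T + ∑ P^c(T) ⊗ R^c(T)`, the sum being over
the proper admissible cuts `c`, with pruned forest `P^c(T)` and trunk `R^c(T)`. The two-vertex
tree has one such cut. The cherry has three: two cut one leaf off, the third one both. -/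
def comulHom : H1 →ₐ[ℂ] H1 ⊗[ℂ] H1 :=
  lift fun
    | t1 => tree t1 ⊗ₜ 1 + 1 ⊗ₜ tree t1
    | t2 => tree t2 ⊗ₜ 1 + 1 ⊗ₜ tree t2 + tree t1 ⊗ₜ tree t1
    | t4 => tree t4 ⊗ₜ 1 + 1 ⊗ₜ tree t4 + (tree t1 ⊗ₜ tree t2 + tree t1 ⊗ₜ tree t2)
              + (tree t1 * tree t1) ⊗ₜ tree t1

/-- The counit: it vanishes on every tree. -/
def counitHom : H1 →ₐ[ℂ] ℂ := lift fun _ => 0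

/-- The antipode. -/
def antipodeHom : H1 →ₐ[ℂ] H1 :=
  lift fun
    | t1 => -tree t1
    | t2 => -tree t2 + tree t1 ^ 2
    | t4 => -tree t4 + 2 * tree t1 * tree t2 - tree t1 ^ 3

instance instBialgebraH1 : Bialgebra ℂ H1 :=
  Bialgebra.ofAlgHom comulHom counitHom
    (by
      apply algHom_ext_H1
      intro i
      have h1 : (1 : H1 ⊗[ℂ] H1) = 1 ⊗ₜ 1 := rfl
      cases i <;> simp [comulHom, TensorProduct.add_tmul, TensorProduct.tmul_add, h1, add_mul,
        mul_add] <;> abel)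
    (by
      apply algHom_ext_H1
      intro i
      cases i <;> simp [comulHom, counitHom])
    (by
      apply algHom_ext_H1
      intro i
      cases i <;> simp [comulHom, counitHom])

theorem comulAlgHom_H1 : Bialgebra.comulAlgHom ℂ H1 = comulHom := by ext1; rfl

theorem counitAlgHom_H1 : Bialgebra.counitAlgHom ℂ H1 = counitHom := by ext1; rfl

theorem toLinearMap_counit_H1 :
    (Coalgebra.counit : H1 →ₗ[ℂ] ℂ) = counitHom.toLinearMap := rfl

instance instHopfAlgebraH1 : HopfAlgebra ℂ H1 :=
  HopfAlgebra.ofAlgHom antipodeHom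
    (by
      apply algHom_ext_H1
      intro i
      simp only [AlgHom.comp_apply, comulAlgHom_H1, counitAlgHom_H1]
      cases i <;> simp [comulHom, counitHom, antipodeHom] <;> ring)
    (by
      apply algHom_ext_H1
      intro i
      simp only [AlgHom.comp_apply, comulAlgHom_H1, counitAlgHom_H1]
      cases i <;> simp [comulHom, counitHom, antipodeHom] <;> ring)

/-- The derivation `Y` of `H1` that multiplies homogeneous elements by their degree. -/
def Y : Derivation ℂ H1 H1 :=
  (MvPolynomial.mkDerivation ℂ fun i => (deg i : ℂ) • MvPolynomial.X i :
    Derivation ℂ (MvPolynomial RTree ℂ) (MvPolynomial RTree ℂ))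

/-- The partial derivative of a polynomial in the trees with respect to the tree `i`. -/
def partialTree (i : RTree) : Derivation ℂ H1 H1 :=
  (MvPolynomial.pderiv i : Derivation ℂ (MvPolynomial RTree ℂ) (MvPolynomial RTree ℂ))

/-! ## Characters and infinitesimal characters -/

section Characters

variable (A : Type) [CommRing A] [Algebra ℂ A]

/-- The set `G_A` of `A`-valued characters. Mathlib's product on it is the convolution product. -/
abbrev Character : Type := WithConv (H1 →ₐ[ℂ] A)

/-- The Lie algebra of linear maps `H1 → A`, with the commutator of the convolution product. -/
abbrev ConvMap : Type := WithConv (H1 →ₗ[ℂ] A)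

instance instLieRingConvMap : LieRing (ConvMap A) := LieRing.ofAssociativeRing

variable {A}

/-- The inverse of a character for the convolution product. -/
def Character.inv (φ : Character A) : Character A := toConv (φ.ofConv.comp antipodeHom)

/-- The convolution algebra of linear maps contains the characters. -/
def Character.toMap (φ : Character A) : ConvMap A := toConv φ.ofConv.toLinearMap

theorem Character.inv_mul (φ : Character A) : φ.inv * φ = 1 := by
  apply WithConv.ext
  apply algHom_ext_H1
  intro i
  change (φ.inv * φ) (tree i) = (1 : Character A) (tree i)
  rw [AlgHom.convMul_apply, AlgHom.convOne_apply, ← Bialgebra.comulAlgHom_apply,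
    ← Bialgebra.counitAlgHom_apply, comulAlgHom_H1, counitAlgHom_H1]
  cases i <;> simp [comulHom, counitHom, Character.inv, antipodeHom, map_ofNat] <;> ring

/-- `Z (h k) = Z(h) ε(k) + ε(h) Z(k)`. -/
def IsInfinitesimal (Z : ConvMap A) : Prop :=
  ∀ h k : H1, Z (h * k) = counitHom k • Z h + counitHom h • Z k

theorem IsInfinitesimal.mul_apply {Z W : ConvMap A} (hZ : IsInfinitesimal Z)
    (hW : IsInfinitesimal W) (h k : H1) :
    (Z * W) (h * k) = counitHom k • (Z * W) h + counitHom h • (Z * W) k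
      + Z h * W k + Z k * W h := by
  have key : ∀ u v : H1 ⊗[ℂ] H1,
      LinearMap.mul' ℂ A (TensorProduct.map Z.ofConv W.ofConv (u * v)) =
        LinearMap.mul' ℂ A (TensorProduct.map Z.ofConv W.ofConv u) *
            algebraMap ℂ A (LinearMap.mul' ℂ ℂ
              (TensorProduct.map counitHom.toLinearMap counitHom.toLinearMap v))
          + algebraMap ℂ A (LinearMap.mul' ℂ ℂ
              (TensorProduct.map counitHom.toLinearMap counitHom.toLinearMap u)) *
            LinearMap.mul' ℂ A (TensorProduct.map Z.ofConv W.ofConv v)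
          + Z (TensorProduct.rid ℂ H1
              (TensorProduct.map LinearMap.id counitHom.toLinearMap u)) *
            W (TensorProduct.lid ℂ H1
              (TensorProduct.map counitHom.toLinearMap LinearMap.id v))
          + Z (TensorProduct.rid ℂ H1
              (TensorProduct.map LinearMap.id counitHom.toLinearMap v)) *
            W (TensorProduct.lid ℂ H1
              (TensorProduct.map counitHom.toLinearMap LinearMap.id u)) := by
    intro u v
    induction u using TensorProduct.induction_on with
    | zero => simp
    | add u₁ u₂ h₁ h₂ => simp only [add_mul, mul_add, map_add, h₁, h₂]; ring
    | tmul a b =>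
      induction v using TensorProduct.induction_on with
      | zero => simp
      | add v₁ v₂ h₁ h₂ => simp only [add_mul, mul_add, map_add, h₁, h₂]; ring
      | tmul c d =>
        have e1 := hZ a c
        have e2 := hW b d
        simp only [Algebra.TensorProduct.tmul_mul_tmul, TensorProduct.map_tmul,
          LinearMap.mul'_apply, e1, e2, TensorProduct.rid_tmul, TensorProduct.lid_tmul, map_smul,
          LinearMap.id_apply, AlgHom.toLinearMap_apply]
        simp only [Algebra.smul_def, map_mul]
        ring
  have hr : ∀ x : H1, TensorProduct.rid ℂ H1
      (TensorProduct.map LinearMap.id counitHom.toLinearMap (Coalgebra.comul x)) = x := by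
    intro x
    rw [← toLinearMap_counit_H1]
    exact (congrArg _ (Coalgebra.lTensor_counit_comul (R := ℂ) x)).trans (by simp)
  have hl : ∀ x : H1, TensorProduct.lid ℂ H1
      (TensorProduct.map counitHom.toLinearMap LinearMap.id (Coalgebra.comul x)) = x := by
    intro x
    rw [← toLinearMap_counit_H1]
    exact (congrArg _ (Coalgebra.rTensor_counit_comul (R := ℂ) x)).trans (by simp)
  have hc : ∀ x : H1, LinearMap.mul' ℂ ℂ (TensorProduct.map counitHom.toLinearMap
      counitHom.toLinearMap (Coalgebra.comul x)) = counitHom x := by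
    intro x
    have e : ∀ u : H1 ⊗[ℂ] H1, LinearMap.mul' ℂ ℂ (TensorProduct.map counitHom.toLinearMap
        counitHom.toLinearMap u) = counitHom (TensorProduct.rid ℂ H1
          (TensorProduct.map LinearMap.id counitHom.toLinearMap u)) := by
      intro u
      induction u using TensorProduct.induction_on with
      | zero => simp
      | add u₁ u₂ h₁ h₂ => simp only [map_add, h₁, h₂]
      | tmul a b => simp [mul_comm]
    rw [e, hr]
  have e := key (Coalgebra.comul h) (Coalgebra.comul k)
  rw [hr, hr, hl, hl, hc, hc] at e
  simp only [LinearMap.convMul_apply, Algebra.smul_def]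
  refine (congrArg (fun u => LinearMap.mul' ℂ A (TensorProduct.map Z.ofConv W.ofConv u))
    (Bialgebra.comul_mul (R := ℂ) h k)).trans (e.trans ?_)
  ring

variable (A) in
/-- The Lie algebra `𝔤_A` of `A`-valued infinitesimal characters, with the bracket
`[Z, W] = Z ⋆ W - W ⋆ Z`. -/
def InfChar : LieSubalgebra ℂ (ConvMap A) where
  carrier := {Z | IsInfinitesimal Z}
  add_mem' := by
    intro Z W hZ hW h k
    have h1 := hZ h k
    have h2 := hW h k
    simp only [ofConv_add, LinearMap.add_apply, h1, h2, smul_add]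
    abel
  zero_mem' := by intro h k; simp
  smul_mem' := by
    intro c Z hZ h k
    have h1 := hZ h k
    simp only [ofConv_smul, LinearMap.smul_apply, h1, smul_add, smul_comm c]
  lie_mem' := by
    intro Z W hZ hW h k
    have h1 := hZ.mul_apply hW h k
    have h2 := hW.mul_apply hZ h k
    simp only [Ring.lie_def, ofConv_sub, LinearMap.sub_apply, h1, h2, smul_sub,
      mul_comm (W h), mul_comm (W k)]
    abel

/-- Composition of an infinitesimal character with a linear map of the target algebra. -/
def InfChar.comp {B : Type} [CommRing B] [Algebra ℂ B] (f : A →ₗ[ℂ] B) (Z : InfChar A) :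
    InfChar B :=
  ⟨toConv (f ∘ₗ Z.1.ofConv), by
    intro h k
    have h1 := Z.2 h k
    simp [h1]⟩

/-- `R̃(φ) = φ⁻¹ ⋆ (φ ∘ Y)`. -/
def Rtilde (φ : Character A) : ConvMap A :=
  φ.inv.toMap * toConv (φ.ofConv.toLinearMap ∘ₗ Y.toLinearMap)

end Characters

/-! ## Laurent series, minimal subtraction, local characters -/

/-- The algebra `ℂ[λ⁻¹, λ]]`. -/
abbrev Laur : Type := LaurentSeries ℂ

/-- The usual `ℂ`-algebra structure, chosen so that its module structure is the coefficientwise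
one. -/
instance instAlgebraLaur : Algebra ℂ Laur := HahnSeries.instAlgebra

/-- The coefficient of `λ ^ k`. -/
def coeffMap (k : ℤ) : Laur →ₗ[ℂ] ℂ where
  toFun f := f.coeff k
  map_add' _ _ := rfl
  map_smul' _ _ := rfl

/-- The minimal subtraction projection: the polar part of a Laurent series. -/
def polarPart : Laur →ₗ[ℂ] Laur := HahnSeries.truncLTLinearMap ℂ (0 : ℤ)

/-- The operator `P₊ - P₋` on `ℂ[λ⁻¹, λ]]`, with `P₋` the polar part and `P₊ = id - P₋`. -/
def rMatrix : Laur →ₗ[ℂ] Laur := (LinearMap.id - polarPart) - polarPart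

/-- The `λ ^ k` coefficient of an infinitesimal character, a `ℂ`-valued infinitesimal
character. -/
def InfChar.coeff (k : ℤ) (Z : InfChar Laur) : InfChar ℂ := InfChar.comp (coeffMap k) Z

/-- `λ ^ k Z`. -/
def InfChar.shift (k : ℤ) (Z : InfChar Laur) : InfChar Laur :=
  InfChar.comp (LinearMap.mulLeft ℂ (HahnSeries.single k (1 : ℂ) : Laur)) Z

/-- The series `e^{zλ}`. -/
def expSeries (z : ℂ) : Laur :=
  ((PowerSeries.rescale z (PowerSeries.exp ℂ) : PowerSeries ℂ) : LaurentSeries ℂ)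

/-- The character `φ^s`, with `φ^s(x) = e^{sλ|x|} φ(x)` for homogeneous `x` of degree `|x|`. -/
def Character.pow (φ : Character Laur) (s : ℂ) : Character Laur :=
  toConv (lift fun i => expSeries (s * deg i) * φ (tree i))

/-- `ψ = φ₋` and `χ = φ₊` in the Birkhoff factorization `φ = φ₋⁻¹ ⋆ φ₊` of `φ`. -/
structure IsBirkhoff (φ ψ χ : Character Laur) : Prop where
  factor : φ = ψ.inv * χ
  minus : ∀ x : H1, counitHom x = 0 → ∀ k : ℤ, 0 ≤ k → (ψ x : Laur).coeff k = 0
  plus : ∀ x : H1, ∀ k : ℤ, k < 0 → (χ x : Laur).coeff k = 0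

/-- The character `φ` is local: `d/ds (φ^s)₋ = 0`. -/
def IsLocal (φ : Character Laur) : Prop :=
  ∃ ψ χ : ℂ → Character Laur, (∀ s, IsBirkhoff (φ.pow s) (ψ s) (χ s)) ∧
    ∀ (s : ℂ) (x : H1) (k : ℤ), HasDerivAt (fun z : ℂ => (ψ z x : Laur).coeff k) 0 s

/-- `B = β̃_φ`, that is `B(x) = d/ds|_{s=0} (φ⁻¹ ⋆ φ^s)(x)` for all `x`. -/
def IsBetaTilde (φ : Character Laur) (B : InfChar Laur) : Prop :=
  ∀ (x : H1) (k : ℤ), HasDerivAt (fun s : ℂ => ((φ.inv * φ.pow s) x : Laur).coeff k)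
    ((B.1 x : Laur).coeff k) 0

/-- `L` is a solution of the Lax pair equation `dL/dt = [L, M]`, `M = R(λ^{-n+2m} L)`. -/
def IsLaxFlow (n m : ℤ) (L : ℝ → InfChar Laur) : Prop :=
  ∀ (t : ℝ) (x : H1) (k : ℤ), HasDerivAt (fun τ : ℝ => ((L τ).1 x : Laur).coeff k)
    ((⁅L t, InfChar.comp rMatrix (InfChar.shift (-n + 2 * m) (L t))⁆.1 x : Laur).coeff k) t

/-- The flow of `β̃`: `φ` is a local character, `L` is the Lax pair flow with `L(0) = R̃(φ)`,
the characters `φ_t = R̃⁻¹(L(t))` form the flow of `φ`, and `B(t) = β̃_{φ_t}`. -/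
structure IsBetaFlow (n m : ℤ) (φ : Character Laur) (L : ℝ → InfChar Laur)
    (φt : ℝ → Character Laur) (B : ℝ → InfChar Laur) : Prop where
  isLocal : IsLocal φ
  init : (L 0).1 = Rtilde φ
  lax : IsLaxFlow n m L
  flow : ∀ t, Rtilde (φt t) = (L t).1
  beta : ∀ t, IsBetaTilde (φt t) (B t)

/-! ## The Lie algebra `𝔤₁` and its double -/

/-- The Lie algebra `𝔤₁` of `ℂ`-valued infinitesimal characters of `H1`. -/
abbrev g1 : Type := InfChar ℂ

/-- The infinitesimal character `Z` with `Z(i) = 1` and `Z(j) = 0` for the trees `j ≠ i`: the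
linear part of a polynomial in the tree `i`. -/
def basisG (i : RTree) : g1 :=
  ⟨toConv (counitHom.toLinearMap ∘ₗ (partialTree i).toLinearMap), by
    intro h k
    simp [Derivation.leibniz]
    ring⟩

theorem basisG_tree (i j : RTree) : (basisG i).1 (tree j) = if i = j then 1 else 0 := by
  have e : partialTree i (tree j) = (Pi.single (M := fun _ => H1) i 1 j : H1) :=
    MvPolynomial.pderiv_X (R := ℂ) i j
  change counitHom (partialTree i (tree j)) = _
  rw [e]
  rcases eq_or_ne i j with h | h
  · subst h; simp
  · simp [h, h.symm]

/-- An infinitesimal character is determined by its values on the trees. -/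
theorem g1_ext {Z W : g1} (h : ∀ i, Z.1 (tree i) = W.1 (tree i)) : Z = W := by
  have h1 : ∀ V : g1, V.1 (1 : H1) = 0 := fun V => by simpa using V.2 1 1
  apply Subtype.ext; apply WithConv.ext
  apply LinearMap.ext; intro x
  refine MvPolynomial.induction_on (motive := fun x => Z.1.ofConv x = W.1.ofConv x) x ?_ ?_ ?_
  · intro a
    have e : ∀ V : g1, V.1.ofConv (MvPolynomial.C a : MvPolynomial RTree ℂ) = 0 := by
      intro V
      have e : (MvPolynomial.C a : MvPolynomial RTree ℂ) = (a • (1 : H1) : H1) :=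
        MvPolynomial.C_eq_smul_one
      rw [e, map_smul, h1, smul_zero]
    rw [e, e]
  · intro p q hp hq
    exact (map_add Z.1.ofConv _ _).trans ((congrArg₂ _ hp hq).trans (map_add W.1.ofConv _ _).symm)
  · intro p i hp
    refine (Z.2 p (tree i)).trans (Eq.trans ?_ (W.2 p (tree i)).symm)
    rw [h i, hp]

/-- The linear form on `𝔤₁` dual to `basisG i`. -/
def dualBasisG (i : RTree) : Module.Dual ℂ g1 where
  toFun Z := Z.1 (tree i)
  map_add' _ _ := rfl
  map_smul' _ _ := rfl

theorem eq_sum_basisG (Z : g1) : Z = ∑ i, dualBasisG i Z • basisG i := by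
  apply g1_ext
  intro j
  change dualBasisG j Z = dualBasisG j (∑ i, dualBasisG i Z • basisG i)
  rw [map_sum]
  have e : ∀ i, dualBasisG j (basisG i) = if i = j then 1 else 0 := fun i => basisG_tree i j
  simp [e]

/-- The double `δ₁ = 𝔤₁ ⊕ 𝔤₁*`. -/
@[ext]
structure Delta1 : Type where
  /-- The component in `𝔤₁`. -/
  vec : g1
  /-- The component in the dual space `𝔤₁*`. -/
  covec : Module.Dual ℂ g1

namespace Delta1

/-- `δ₁` as a vector space is the product `𝔤₁ × 𝔤₁*`. -/
def equivProd : Delta1 ≃ g1 × Module.Dual ℂ g1 where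
  toFun x := (x.vec, x.covec)
  invFun p := ⟨p.1, p.2⟩
  left_inv _ := rfl
  right_inv _ := rfl

instance instAddCommGroup : AddCommGroup Delta1 := equivProd.addCommGroup

instance instModule : Module ℂ Delta1 := equivProd.module ℂ

@[simp] theorem vec_add (x y : Delta1) : (x + y).vec = x.vec + y.vec := rfl

@[simp] theorem covec_add (x y : Delta1) : (x + y).covec = x.covec + y.covec := rfl

@[simp] theorem vec_zero : (0 : Delta1).vec = 0 := rfl

@[simp] theorem covec_zero : (0 : Delta1).covec = 0 := rfl

@[simp] theorem vec_smul (c : ℂ) (x : Delta1) : (c • x).vec = c • x.vec := rfl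

@[simp] theorem covec_smul (c : ℂ) (x : Delta1) : (c • x).covec = c • x.covec := rfl

/-- `[X + ξ, Y + η] = [X, Y] + ad*_X η - ad*_Y ξ`, with `(ad*_X η)(Z) = -η([X, Z])`. -/
instance instBracket : Bracket Delta1 Delta1 where
  bracket x y := ⟨⁅x.vec, y.vec⁆, ⁅x.vec, y.covec⁆ - ⁅y.vec, x.covec⁆⟩

@[simp] theorem vec_lie (x y : Delta1) : ⁅x, y⁆.vec = ⁅x.vec, y.vec⁆ := rfl

@[simp] theorem covec_lie (x y : Delta1) :
    ⁅x, y⁆.covec = ⁅x.vec, y.covec⁆ - ⁅y.vec, x.covec⁆ := rfl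

instance instLieRing : LieRing Delta1 where
  add_lie x y z := by
    ext1 <;> simp only [vec_lie, covec_lie, vec_add, covec_add, add_lie, lie_add]
    abel
  lie_add x y z := by
    ext1 <;> simp only [vec_lie, covec_lie, vec_add, covec_add, add_lie, lie_add]
    abel
  lie_self x := by
    ext1
    · exact lie_self x.vec
    · exact sub_self _
  leibniz_lie x y z := by
    ext1 <;> simp only [vec_lie, covec_lie, vec_add, covec_add, lie_sub, lie_lie] <;> abel

instance instLieAlgebra : LieAlgebra ℂ Delta1 where
  lie_smul c x y := by
    ext1 <;> simp only [vec_lie, covec_lie, vec_smul, covec_smul, lie_smul, smul_lie, smul_sub]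

/-- The inclusion of `𝔤₁` in `δ₁`. -/
@[simps]
def ofG (Z : g1) : Delta1 := ⟨Z, 0⟩

/-- The inclusion of `𝔤₁*` in `δ₁`. -/
@[simps]
def ofDual (ξ : Module.Dual ℂ g1) : Delta1 := ⟨0, ξ⟩

/-- The natural pairing `⟨X + ξ, Y + η⟩ = ξ(Y) + η(X)`. -/
def pairing (x y : Delta1) : ℂ := x.covec y.vec + y.covec x.vec

end Delta1

open Delta1

/-- The index set of the coordinates on `δ₁`: `inl` for the `x_i`, `inr` for the `x_i^*`. -/
abbrev Idx : Type := RTree ⊕ RTree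

/-- The coordinates on `𝔤₁ ⊕ 𝔤₁*`: `x_i(Z + ξ) = Z(i)` and `x_i^*(Z + ξ) = ξ(Z_i)`, with `Z_i` the
basis of `𝔤₁` dual to the trees. -/
def coords (x : Delta1) : Idx → ℂ :=
  Sum.elim (fun i => x.vec.1 (tree i)) (fun i => x.covec (basisG i))

/-- The topology of the finite-dimensional space `δ₁`. -/
instance instTopologicalSpace : TopologicalSpace Delta1 := TopologicalSpace.induced coords inferInstance

/-- The basis `X_i`, `X_i^*` of `δ₁`. -/
def basisD : Idx → Delta1 := Sum.elim (fun i => ofG (basisG i)) (fun i => ofDual (dualBasisG i))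

/-! ## Polynomial functions and Poisson brackets on `δ₁` -/

/-- The polynomial functions on `δ₁`, as polynomials in the coordinates. -/
abbrev Poly : Type := MvPolynomial Idx ℂ

/-- The coordinate functions `x_i`. -/
abbrev cx (i : RTree) : Poly := MvPolynomial.X (Sum.inl i)

/-- The coordinate functions `x_i^*`. -/
abbrev cs (i : RTree) : Poly := MvPolynomial.X (Sum.inr i)

/-- The value of a polynomial function at a point of `δ₁`. -/
def value (f : Poly) (x : Delta1) : ℂ := MvPolynomial.eval (coords x) f

/-- The differential of a polynomial function at a point, in coordinates. -/
def diff (f : Poly) (x : Delta1) : Idx → ℂ := fun a => value (MvPolynomial.pderiv a f) x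

/-- The coordinate gradient `∑ ∂f/∂x_i X_i + ∑ ∂f/∂x_i^* X_i^*`. -/
def grad (f : Poly) (x : Delta1) : Delta1 := ∑ a, diff f x a • basisD a

/-- The gradient for the natural pairing: `⟨∇f(x), v⟩ = df_x(v)`; this is
`∑ ∂f/∂x_i^* X_i + ∑ ∂f/∂x_i X_i^*`. -/
def pairingGrad (f : Poly) (x : Delta1) : Delta1 := ∑ a, diff f x a • basisD a.swap

/-- The linear function `x ↦ ⟨x, y⟩`. -/
def pairingPoly (y : Delta1) : Poly := ∑ a : Idx, MvPolynomial.C (coords y a) * MvPolynomial.X a.swap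

theorem value_pairingPoly (y x : Delta1) : value (pairingPoly y) x = pairing x y := by
  have h1 : x.covec y.vec = ∑ i, dualBasisG i y.vec * x.covec (basisG i) := by
    conv_lhs => rw [eq_sum_basisG y.vec]
    simp
  have h2 : y.covec x.vec = ∑ i, y.covec (basisG i) * dualBasisG i x.vec := by
    conv_lhs => rw [eq_sum_basisG x.vec]
    simp [mul_comm]
  simp only [pairing, h1, h2, value, pairingPoly, Fintype.sum_sum_type, map_add, map_sum, map_mul,
    MvPolynomial.eval_C, MvPolynomial.eval_X, Sum.swap_inl, Sum.swap_inr]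
  rfl

/-- The biderivation of the algebra of polynomial functions with given values
`{x_a, x_b} = W a b` on the coordinates. -/
def bracketOf (W : Idx → Idx → Poly) (f g : Poly) : Poly :=
  ∑ a, ∑ b, MvPolynomial.pderiv a f * MvPolynomial.pderiv b g * W a b

/-- The bracket with `{x_a, x_b}(x) = ⟨x, [e_a, e_b]⟩`, that is
`{f, g}(x) = ⟨x, [grad f(x), grad g(x)]⟩` with the coordinate gradients. -/
def coordBracket : Idx → Idx → Poly := fun a b => pairingPoly ⁅basisD a, basisD b⁆

/-- The Lie-Poisson bracket of `δ₁*` carried to `δ₁` by the natural pairing: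
`{f, g}(x) = ⟨x, [∇f(x), ∇g(x)]⟩` with the gradients for the pairing. -/
def lieBracket : Idx → Idx → Poly := fun a b => pairingPoly ⁅basisD a.swap, basisD b.swap⁆

theorem pairing_lie_sum (x : Delta1) (u v : Idx → ℂ) (e : Idx → Delta1) :
    pairing x ⁅∑ a, u a • e a, ∑ b, v b • e b⁆ =
      ∑ a, ∑ b, u a * v b * pairing x ⁅e a, e b⁆ := by
  let P : Delta1 →ₗ[ℂ] ℂ :=
    { toFun := fun y => pairing x y
      map_add' := fun y z => by simp [pairing]; ring
      map_smul' := fun c y => by simp [pairing]; ring }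
  change P _ = ∑ a, ∑ b, u a * v b * P _
  simp_rw [sum_lie, lie_sum, map_sum, smul_lie, lie_smul, map_smul, smul_eq_mul, mul_assoc]

theorem value_coordBracket (f g : Poly) (x : Delta1) :
    value (bracketOf coordBracket f g) x = pairing x ⁅grad f x, grad g x⁆ := by
  rw [grad, grad, pairing_lie_sum]
  simp only [← value_pairingPoly]
  simp [bracketOf, coordBracket, value, diff]

theorem value_lieBracket (f g : Poly) (x : Delta1) :
    value (bracketOf lieBracket f g) x = pairing x ⁅pairingGrad f x, pairingGrad g x⁆ := by
  rw [pairingGrad, pairingGrad, pairing_lie_sum]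
  simp only [← value_pairingPoly]
  simp [bracketOf, lieBracket, value, diff]

/-- `W` defines a Poisson bracket. -/
structure IsPoisson (W : Idx → Idx → Poly) : Prop where
  skew : ∀ f g, bracketOf W f g = -bracketOf W g f
  leibniz : ∀ f g h, bracketOf W f (g * h) = bracketOf W f g * h + g * bracketOf W f h
  jacobi : ∀ f g h, bracketOf W f (bracketOf W g h) + bracketOf W g (bracketOf W h f)
    + bracketOf W h (bracketOf W f g) = 0

/-- The Poisson structure has rank `r`: the maximal rank of the Poisson tensor is `r`. -/
def HasRank (W : Idx → Idx → Poly) (r : ℕ) : Prop :=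
  (∀ x, (Matrix.of fun a b => value (W a b) x).rank ≤ r) ∧
    ∃ x, (Matrix.of fun a b => value (W a b) x).rank = r

/-- The functions `F` are pairwise in involution. -/
def InInvolution {ι : Type} (W : Idx → Idx → Poly) (F : ι → Poly) : Prop :=
  ∀ i j, bracketOf W (F i) (F j) = 0

/-- The differentials of the functions `F` are linearly independent on an open dense set. -/
def IndependentOnOpenDense {ι : Type} (F : ι → Poly) : Prop :=
  ∃ U : Set Delta1, IsOpen U ∧ Dense U ∧ ∀ x ∈ U, LinearIndependent ℂ fun i => diff (F i) x

/-- `γ` is an integral curve of the Hamiltonian vector field of `K`: along `γ` every function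
satisfies `df/dt = {f, K}`. -/
def IsHamiltonianCurve (W : Idx → Idx → Poly) (K : Poly) (γ : ℝ → Delta1) : Prop :=
  ∀ (f : Poly) (t : ℝ),
    HasDerivAt (fun τ => value f (γ τ)) (value (bracketOf W f K) (γ t)) t

/-- `v` is the derivative of the curve `γ` in `δ₁` at `t`. -/
def HasVelocity (γ : ℝ → Delta1) (v : Delta1) (t : ℝ) : Prop :=
  ∀ a, HasDerivAt (fun τ => coords (γ τ) a) (coords v a) t

/-- `∑ k_i x_i + ∑ l_i x_i² / 2`. -/
def quadH (k l : RTree → ℂ) : Poly :=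
  ∑ i, (MvPolynomial.C (k i) * cx i + MvPolynomial.C (l i / 2) * cx i ^ 2)

/-- The functions `H`, `H₂ = x₃²/2`, `H₃ = x₁*²/2`, `H₄ = x₂*²/2`,
`H₅ = x₃*²/2 + x₁²/2 + x₂²/2`; the third coordinate belongs to the tree `t4`. -/
def familyH (k l : RTree → ℂ) : Fin 5 → Poly :=
  ![quadH k l,
    MvPolynomial.C (1 / 2) * cx t4 ^ 2,
    MvPolynomial.C (1 / 2) * cs t1 ^ 2,
    MvPolynomial.C (1 / 2) * cs t2 ^ 2,
    MvPolynomial.C (1 / 2) * (cs t4 ^ 2 + cx t1 ^ 2 + cx t2 ^ 2)]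

/-- `∑ (k_i + l_i x_i) x_i^*`. Its gradient for the pairing and the coordinate gradient of
`quadH k l` are equal at the points of `𝔤₁`. -/
def liftH (k l : RTree → ℂ) : Poly :=
  ∑ i, (MvPolynomial.C (k i) + MvPolynomial.C (l i) * cx i) * cs i

/-- The functions `Ĥ = ∑ (k_i + l_i x_i) x_i^*`, `x₁`, `x₂`, `x₃*` and
`⟨x, x⟩/2 = x₁x₁* + x₂x₂* + x₃x₃*`. -/
def familyL (k l : RTree → ℂ) : Fin 5 → Poly :=
  ![liftH k l, cx t1, cx t2, cs t4, ∑ i, cx i * cs i]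

end RootedTreeFlow

end

open scoped TensorProduct
open WithConv

noncomputable section

namespace RootedTreeFlow

open RTree Delta1

/-! Everything reduces to three components. An infinitesimal character kills `1` and products of
trees, so the only surviving part of the bracket is `2(Z₁W₂ - W₁Z₂)` on the cherry (`lie_t1`,
`lie_t2`, `lie_t4`). Hence along the Lax flow the components on `t1` and `t2` are frozen. The slope
on the cherry depends on those two alone, so it is constant and the flow is affine
(`IsLaxFlow.tree_eq`, `IsLaxFlow.coeff_t4`).

Differentiating `φ⁻¹ ⋆ φ^s` at `s = 0` gives `λ R̃(φ)` (`hasDerivAt_inv_mul_pow`), so `β̃₀` is the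
residue of `L` and `β̃_p` its coefficient of index `n - 2m`. Locality makes `φ⁻¹ ⋆ φ^s` regular, so
the frozen components have at most simple poles (`IsLocal.coeff_Rtilde`). Since `R = 2P₊ - id` and
the identity part commutes away, the residue of the Lax commutator involves only the residues and
the coefficients of index `n - 2m` (`coeff_lax`). It is the cherry component of `2[β̃₀, β̃_p]`.

Each Poisson bracket has the form `2 w · (∇f × ∇g)` in three active coordinates, with `w = (x₁, x₂,
x₃*)`. For the coordinate bracket, `w` itself consists of the active coordinates, and `|w|²/2` is a
Casimir. For the Lie-Poisson bracket the active coordinates are `x₁*, x₂*, x₃`, the entries of `w`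
are Casimirs, and so is `⟨x, x⟩/2`. In each family at most one member fails to be a Casimir, which
gives involution. The constants `k, l` are fitted to the affine curves, with `l₁ = 1` and `l₂ = 0`
so that both families are generically independent. On `𝔤₁` the pairing gradient of `Ĥ` equals the
coordinate gradient of `H`, which turns the gradient equation into a Hamiltonian one. -/

theorem comul_tree (i : RTree) :
    (Coalgebra.comul (tree i) : H1 ⊗[ℂ] H1) = comulHom (tree i) := by
  rw [← comulAlgHom_H1]; rfl

/-! ### Convolution, bracket and `R̃` in tree components -/

section Components

variable {A : Type} [CommRing A] [Algebra ℂ A]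

theorem ConvMap.mul_t1 (Z W : ConvMap A) :
    (Z * W) (tree t1) = Z (tree t1) * W 1 + Z 1 * W (tree t1) := by
  rw [LinearMap.convMul_apply, comul_tree]
  simp [comulHom]

theorem ConvMap.mul_t2 (Z W : ConvMap A) :
    (Z * W) (tree t2) = Z (tree t2) * W 1 + Z 1 * W (tree t2) + Z (tree t1) * W (tree t1) := by
  rw [LinearMap.convMul_apply, comul_tree]
  simp [comulHom]

theorem ConvMap.mul_t4 (Z W : ConvMap A) :
    (Z * W) (tree t4) = Z (tree t4) * W 1 + Z 1 * W (tree t4) + 2 * (Z (tree t1) * W (tree t2))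
      + Z (tree t1 * tree t1) * W (tree t1) := by
  rw [LinearMap.convMul_apply, comul_tree]
  simp [comulHom]
  ring

theorem IsInfinitesimal.map_one {Z : ConvMap A} (hZ : IsInfinitesimal Z) : Z (1 : H1) = 0 := by
  simpa using hZ 1 1

theorem counitHom_tree (i : RTree) : counitHom (tree i) = 0 := by simp [counitHom]

/-- This removes the cubic term `t1² ⊗ t1` of the coproduct from the bracket. -/
theorem IsInfinitesimal.map_tree_mul_tree {Z : ConvMap A} (hZ : IsInfinitesimal Z)
    (i j : RTree) : Z (tree i * tree j) = 0 := by
  simpa [counitHom_tree] using hZ (tree i) (tree j)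

theorem lie_apply (Z W : InfChar A) (x : H1) :
    ⁅Z, W⁆.1 x = (Z.1 * W.1) x - (W.1 * Z.1) x := rfl

theorem lie_t1 (Z W : InfChar A) : ⁅Z, W⁆.1 (tree t1) = 0 := by
  rw [lie_apply, ConvMap.mul_t1, ConvMap.mul_t1, Z.2.map_one, W.2.map_one]
  ring

theorem lie_t2 (Z W : InfChar A) : ⁅Z, W⁆.1 (tree t2) = 0 := by
  rw [lie_apply, ConvMap.mul_t2, ConvMap.mul_t2, Z.2.map_one, W.2.map_one]
  ring

theorem lie_t4 (Z W : InfChar A) : ⁅Z, W⁆.1 (tree t4) =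
    2 * (Z.1 (tree t1) * W.1 (tree t2) - W.1 (tree t1) * Z.1 (tree t2)) := by
  rw [lie_apply, ConvMap.mul_t4, ConvMap.mul_t4, Z.2.map_one, W.2.map_one,
    Z.2.map_tree_mul_tree, W.2.map_tree_mul_tree]
  ring

theorem Character.mul_t1 (φ ψ : Character A) :
    (φ * ψ) (tree t1) = φ (tree t1) + ψ (tree t1) := by
  refine (ConvMap.mul_t1 φ.toMap ψ.toMap).trans ?_
  simp [Character.toMap]

theorem Character.mul_t2 (φ ψ : Character A) :
    (φ * ψ) (tree t2) = φ (tree t2) + ψ (tree t2) + φ (tree t1) * ψ (tree t1) := by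
  refine (ConvMap.mul_t2 φ.toMap ψ.toMap).trans ?_
  simp [Character.toMap]

theorem Character.mul_t4 (φ ψ : Character A) :
    (φ * ψ) (tree t4) = φ (tree t4) + ψ (tree t4) + 2 * (φ (tree t1) * ψ (tree t2))
      + φ (tree t1) ^ 2 * ψ (tree t1) := by
  refine (ConvMap.mul_t4 φ.toMap ψ.toMap).trans ?_
  simp [Character.toMap, sq]

theorem Character.inv_t1 (φ : Character A) : φ.inv (tree t1) = -φ (tree t1) := by
  simp [Character.inv, antipodeHom]

theorem Character.inv_t2 (φ : Character A) :
    φ.inv (tree t2) = -φ (tree t2) + φ (tree t1) ^ 2 := by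
  simp [Character.inv, antipodeHom]

theorem Character.inv_t4 (φ : Character A) :
    φ.inv (tree t4) = -φ (tree t4) + 2 * φ (tree t1) * φ (tree t2) - φ (tree t1) ^ 3 := by
  simp [Character.inv, antipodeHom, map_ofNat]

theorem Character.mul_inv (φ : Character A) : φ * φ.inv = 1 := by
  have h := φ.inv.inv_mul
  calc φ * φ.inv = (φ.inv.inv * φ.inv) * (φ * φ.inv) := by rw [h, one_mul]
    _ = φ.inv.inv * ((φ.inv * φ) * φ.inv) := by simp only [mul_assoc]
    _ = 1 := by rw [φ.inv_mul, one_mul, h]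

theorem Character.inv_mul_of_eq {φ ψ χ : Character A} (h : φ = ψ.inv * χ) :
    φ.inv = χ.inv * ψ := by
  have h1 : (χ.inv * ψ) * φ = 1 := by
    rw [h, mul_assoc, ← mul_assoc ψ, ψ.mul_inv, one_mul, χ.inv_mul]
  calc φ.inv = ((χ.inv * ψ) * φ) * φ.inv := by rw [h1, one_mul]
    _ = χ.inv * ψ := by rw [mul_assoc, φ.mul_inv, mul_one]

/-- A common left factor cancels. It is applied to `φ` and `φ^s`, which share their counterterm when
`φ` is local. -/
theorem Character.inv_mul_of_eq_inv_mul {φ φ' ψ χ χ' : Character A} (h : φ = ψ.inv * χ)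
    (h' : φ' = ψ.inv * χ') : φ.inv * φ' = χ.inv * χ' := by
  rw [Character.inv_mul_of_eq h, h', mul_assoc, ← mul_assoc ψ, ψ.mul_inv, one_mul]

theorem Character.inv_mul_t1 (φ ψ : Character A) :
    (φ.inv * ψ) (tree t1) = ψ (tree t1) - φ (tree t1) := by
  rw [Character.mul_t1, Character.inv_t1]
  ring

theorem Character.inv_mul_t2 (φ ψ : Character A) : (φ.inv * ψ) (tree t2) =
    ψ (tree t2) - φ (tree t2) + φ (tree t1) * φ (tree t1) - φ (tree t1) * ψ (tree t1) := by
  rw [Character.mul_t2, Character.inv_t1, Character.inv_t2]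
  ring

theorem Y_tree (i : RTree) : Y (tree i) = (deg i : ℂ) • tree i :=
  MvPolynomial.mkDerivation_X ℂ (fun i => (deg i : ℂ) • (MvPolynomial.X i : MvPolynomial RTree ℂ)) i

theorem Rtilde_t1 (φ : Character A) : Rtilde φ (tree t1) = φ (tree t1) := by
  refine (ConvMap.mul_t1 _ _).trans ?_
  simp [Character.toMap, Y_tree, deg]

theorem Rtilde_t2 (φ : Character A) :
    Rtilde φ (tree t2) = 2 * φ (tree t2) - φ (tree t1) ^ 2 := by
  refine (ConvMap.mul_t2 _ _).trans ?_
  simp [Character.toMap, Y_tree, deg, Character.inv_t1, Algebra.smul_def, map_ofNat]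
  ring

theorem Rtilde_t4 (φ : Character A) :
    Rtilde φ (tree t4) = 3 * φ (tree t4) - 4 * (φ (tree t1) * φ (tree t2)) + φ (tree t1) ^ 3 := by
  refine (ConvMap.mul_t4 _ _).trans ?_
  simp [Character.toMap, Y_tree, deg, Character.inv_t1, Algebra.smul_def, map_ofNat]
  ring

end Components

/-! ### Laurent coefficients, the operator `R`, exponential series -/

section Laurent

theorem coeff_mul_eq_zero_of_lt {f g : Laur} {a b k : ℤ} (hf : ∀ i < a, f.coeff i = 0)
    (hg : ∀ j < b, g.coeff j = 0) (hk : k < a + b) : (f * g).coeff k = 0 := by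
  rw [HahnSeries.coeff_mul]
  refine Finset.sum_eq_zero fun p hp => ?_
  rw [Finset.mem_antidiagonal] at hp
  rcases lt_or_ge p.1 a with h | h
  · rw [hf _ h, zero_mul]
  · rw [hg p.2 (by have := hp.2.2; omega), mul_zero]

/-- Lowest-order terms multiply: `(a, b)` is the only pair of indices with sum `a + b` that can
contribute. -/
theorem coeff_mul_add {f g : Laur} {a b : ℤ} (hf : ∀ i < a, f.coeff i = 0)
    (hg : ∀ j < b, g.coeff j = 0) : (f * g).coeff (a + b) = f.coeff a * g.coeff b := by
  rw [HahnSeries.coeff_mul]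
  refine Finset.sum_eq_single (a, b) (fun p hp hne => ?_) (fun h => ?_)
  · rw [Finset.mem_antidiagonal] at hp
    rcases lt_or_ge p.1 a with h | h
    · rw [hf _ h, zero_mul]
    · rcases lt_or_ge p.2 b with h' | h'
      · rw [hg _ h', mul_zero]
      · refine absurd (Prod.ext ?_ ?_) hne <;> have := hp.2.2 <;> simp only <;> omega
  · by_contra h0
    refine h ?_
    rw [Finset.mem_antidiagonal]
    exact ⟨left_ne_zero_of_mul h0, right_ne_zero_of_mul h0, rfl⟩

theorem rMatrix_apply (f : Laur) : rMatrix f = 2 * (f - polarPart f) - f := by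
  simp only [rMatrix, LinearMap.sub_apply, LinearMap.id_apply]
  ring

theorem coeff_sub_polarPart_of_lt (f : Laur) {k : ℤ} (hk : k < 0) :
    (f - polarPart f).coeff k = 0 := by
  rw [HahnSeries.coeff_sub, sub_eq_zero]
  exact (HahnSeries.coeff_truncLT_of_lt hk f).symm

theorem coeff_sub_polarPart_of_le (f : Laur) {k : ℤ} (hk : 0 ≤ k) :
    (f - polarPart f).coeff k = f.coeff k := by
  rw [HahnSeries.coeff_sub, sub_eq_self]
  exact HahnSeries.coeff_truncLT_of_le hk f

theorem coeff_single_one_mul (q k : ℤ) (f : Laur) :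
    ((HahnSeries.single q (1 : ℂ) : Laur) * f).coeff k = f.coeff (k - q) := by
  rw [HahnSeries.coeff_single_mul, one_mul]

/-- The residue of the Lax commutator of two series with at most simple poles. -/
theorem coeff_lax {u v : Laur} (hu : ∀ i < -1, u.coeff i = 0) (hv : ∀ i < -1, v.coeff i = 0)
    (q : ℤ) :
    (2 * (u * rMatrix (HahnSeries.single (-q) (1 : ℂ) * v)
      - rMatrix (HahnSeries.single (-q) (1 : ℂ) * u) * v) : Laur).coeff (-1) =
    4 * (u.coeff (-1) * v.coeff q - u.coeff q * v.coeff (-1)) := by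
  set S : Laur := HahnSeries.single (-q) (1 : ℂ)
  -- Writing `R = 2P₊ - id`, the identity parts cancel because `u(Sv) = (Su)v`. What remains are
  -- products of a series with at most a simple pole and a regular one, so residues come from
  -- lowest-order terms only.
  have e : (2 * (u * rMatrix (S * v) - rMatrix (S * u) * v) : Laur) =
      (4 : ℕ) • (u * (S * v - polarPart (S * v)) - (S * u - polarPart (S * u)) * v) := by
    rw [rMatrix_apply, rMatrix_apply]
    simp only [nsmul_eq_mul]
    push_cast
    ring
  have h1 := coeff_mul_add (b := 0) hu
    (fun j hj => coeff_sub_polarPart_of_lt (S * v) hj)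
  have h2 := coeff_mul_add (a := 0)
    (fun j hj => coeff_sub_polarPart_of_lt (S * u) hj) hv
  rw [coeff_sub_polarPart_of_le _ le_rfl, coeff_single_one_mul] at h1 h2
  rw [e, HahnSeries.coeff_nsmul, Pi.smul_apply, HahnSeries.coeff_sub]
  simp only [add_zero, zero_add, zero_sub, neg_neg] at h1 h2
  rw [h1, h2]
  simp

theorem expSeries_coeff_of_lt (z : ℂ) {i : ℤ} (hi : i < 0) : (expSeries z).coeff i = 0 := by
  rw [expSeries, PowerSeries.coeff_coe, if_pos hi]

theorem hasDerivAt_expSeries_coeff (d : ℂ) (i : ℤ) :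
    HasDerivAt (fun s : ℂ => (expSeries (s * d)).coeff i)
      ((HahnSeries.single 1 d : Laur).coeff i) 0 := by
  rcases lt_or_ge i 0 with hi | hi
  · simp_rw [expSeries_coeff_of_lt _ hi]
    rw [HahnSeries.coeff_single_of_ne (by omega)]
    exact hasDerivAt_const _ _
  · lift i to ℕ using hi
    have e : (fun s : ℂ => (expSeries (s * d)).coeff i) =
        fun s => (s * d) ^ i * algebraMap ℚ ℂ (1 / (i.factorial : ℚ)) := by
      ext s
      rw [expSeries, PowerSeries.coeff_coe, if_neg (by omega), PowerSeries.coeff_rescale,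
        Int.natAbs_natCast, PowerSeries.coeff_exp]
    rw [e]
    have h := (((hasDerivAt_id (0 : ℂ)).mul_const d).pow i).mul_const
      (algebraMap ℚ ℂ (1 / (i.factorial : ℚ)))
    refine h.congr_deriv ?_
    rcases i with _ | _ | i
    · simp
    · simp
    · rw [HahnSeries.coeff_single_of_ne (by omega)]
      simp

theorem hasDerivAt_coeff_expSeries_mul (d : ℂ) (f : Laur) (k : ℤ) :
    HasDerivAt (fun s : ℂ => (expSeries (s * d) * f).coeff k) (d * f.coeff (k - 1)) 0 := by
  -- All the exponential series are supported in `[0, ∞)`. A coefficient of the product is therefore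
  -- a sum over one finite index set independent of `s`, and may be differentiated term by term.
  have hs : (Set.Ici (0 : ℤ)).IsPWO := bddBelow_Ici.isWF.isPWO
  have h1 : ∀ s, (expSeries (s * d)).support ⊆ Set.Ici 0 := by
    intro s i hi
    by_contra h
    exact hi (expSeries_coeff_of_lt _ (not_le.1 h))
  have h2 : (HahnSeries.single 1 d : Laur).support ⊆ Set.Ici 0 := by
    intro i hi
    have := HahnSeries.support_single_subset hi
    simp only [Set.mem_singleton_iff] at this
    simp [this]
  -- The claimed derivative is read as a coefficient of `(dλ) f`, expanded over the same index set.
  rw [← HahnSeries.coeff_single_mul, HahnSeries.coeff_mul_left' hs h2]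
  simp_rw [fun s => HahnSeries.coeff_mul_left' (x := expSeries (s * d)) (y := f) (a := k) hs (h1 s)]
  exact HasDerivAt.fun_sum fun p _ => (hasDerivAt_expSeries_coeff d p.1).mul_const _

end Laurent

/-! ### Local characters and the Lax flow -/

section Flow

theorem Character.pow_tree (φ : Character Laur) (s : ℂ) (i : RTree) :
    φ.pow s (tree i) = expSeries (s * deg i) * φ (tree i) := by
  simp [Character.pow]

/-- The derivative of `φ⁻¹ ⋆ φ^s` at `s = 0` is `λ R̃(φ)`. -/
theorem hasDerivAt_inv_mul_pow (φ : Character Laur) (i : RTree) (k : ℤ) :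
    HasDerivAt (fun s : ℂ => ((φ.inv * φ.pow s) (tree i) : Laur).coeff k)
      ((Rtilde φ (tree i) : Laur).coeff (k - 1)) 0 := by
  have D := fun (j : RTree) (f : Laur) => hasDerivAt_coeff_expSeries_mul (deg j) f k
  set a : Laur := φ (tree t1) with ha
  set b : Laur := φ (tree t2) with hb
  set c : Laur := φ (tree t4) with hc
  cases i
  · have e : ∀ s, ((φ.inv * φ.pow s) (tree t1) : Laur) =
        -a + expSeries (s * deg t1) * a := by
      intro s
      rw [Character.mul_t1, Character.inv_t1, φ.pow_tree]
    simp_rw [e, HahnSeries.coeff_add]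
    refine ((D t1 a).const_add _).congr_deriv ?_
    rw [Rtilde_t1, ← ha]
    simp [deg]
  · have e : ∀ s, ((φ.inv * φ.pow s) (tree t2) : Laur) =
        (-b + a ^ 2) + expSeries (s * deg t2) * b - expSeries (s * deg t1) * a ^ 2 := by
      intro s
      rw [Character.mul_t2, Character.inv_t1, Character.inv_t2, φ.pow_tree, φ.pow_tree]
      ring
    simp_rw [e, HahnSeries.coeff_sub, HahnSeries.coeff_add]
    refine (((D t2 b).const_add _).sub (D t1 (a ^ 2))).congr_deriv ?_
    rw [Rtilde_t2, ← ha, ← hb, two_mul]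
    simp only [HahnSeries.coeff_sub, HahnSeries.coeff_add, deg]
    push_cast
    ring
  -- The factor `2` is written as a repeated term, so that taking coefficients needs additivity
  -- only.
  · have e : ∀ s, ((φ.inv * φ.pow s) (tree t4) : Laur) =
        (-c + 2 * a * b - a ^ 3) + expSeries (s * deg t4) * c
          - expSeries (s * deg t2) * (a * b) - expSeries (s * deg t2) * (a * b)
          + expSeries (s * deg t1) * a ^ 3 := by
      intro s
      rw [Character.mul_t4, Character.inv_t1, Character.inv_t4, φ.pow_tree, φ.pow_tree,
        φ.pow_tree]
      ring
    have e' : Rtilde φ (tree t4) =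
        c + c + c - (a * b + a * b + a * b + a * b) + a ^ 3 := by
      rw [Rtilde_t4]
      ring
    simp_rw [e, HahnSeries.coeff_add, HahnSeries.coeff_sub]
    refine (((((D t4 c).const_add _).sub (D t2 (a * b))).sub (D t2 (a * b))).add
      (D t1 (a ^ 3))).congr_deriv ?_
    rw [e']
    simp only [HahnSeries.coeff_sub, HahnSeries.coeff_add, deg]
    push_cast
    ring

theorem IsBetaTilde.coeff_tree {φ : Character Laur} {B : InfChar Laur} (h : IsBetaTilde φ B)
    (i : RTree) (k : ℤ) :
    (B.1 (tree i) : Laur).coeff k = (Rtilde φ (tree i) : Laur).coeff (k - 1) :=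
  (h (tree i) k).unique (hasDerivAt_inv_mul_pow φ i k)

/-- For a local character `φ` the characters `φ⁻¹ ⋆ φ^s` have no poles. -/
theorem IsLocal.exists_regular {φ : Character Laur} (h : IsLocal φ) :
    ∃ χ : ℂ → Character Laur, (∀ s (x : H1), ∀ k < 0, (χ s x : Laur).coeff k = 0) ∧
      ∀ s, φ.inv * φ.pow s = (χ 0).inv * χ s := by
  obtain ⟨ψ, χ, hb, hd⟩ := h
  -- Locality says the negative part does not depend on `s`; since `φ^0 = φ`, it is also the
  -- negative part of `φ`.
  have hψ : ∀ s, ψ s = ψ 0 := by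
    intro s
    apply WithConv.ext
    apply AlgHom.ext
    intro x
    apply HahnSeries.ext
    ext k
    exact is_const_of_deriv_eq_zero (fun z => (hd z x k).differentiableAt)
      (fun z => (hd z x k).deriv) s 0
  have h0 : φ.pow 0 = φ := by
    have e : expSeries 0 = 1 := by simp [expSeries]
    apply WithConv.ext
    apply algHom_ext_H1
    intro i
    refine (φ.pow_tree 0 i).trans ?_
    rw [zero_mul, e, one_mul]
  refine ⟨χ, fun s => (hb s).plus, fun s => ?_⟩
  have e := (hb 0).factor
  rw [h0] at e
  exact Character.inv_mul_of_eq_inv_mul e (hψ s ▸ (hb s).factor)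

/-- The curve `φ⁻¹ ⋆ φ^s = χ₀⁻¹ ⋆ χ_s` has no poles, hence neither does its derivative `λ R̃(φ)`.
Only the components that enter the bracket are needed. -/
theorem IsLocal.coeff_Rtilde {φ : Character Laur} (h : IsLocal φ) {i : RTree} (hi : i ≠ t4)
    {k : ℤ} (hk : k < -1) : (Rtilde φ (tree i) : Laur).coeff k = 0 := by
  obtain ⟨χ, hχ, he⟩ := h.exists_regular
  have hd := hasDerivAt_inv_mul_pow φ i (k + 1)
  rw [add_sub_cancel_right] at hd
  have hm : ∀ s s' (x y : H1), (χ s x * χ s' y : Laur).coeff (k + 1) = 0 := fun s s' x y =>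
    coeff_mul_eq_zero_of_lt (hχ s x) (hχ s' y) (by omega)
  have h1 : ∀ s (x : H1), (χ s x : Laur).coeff (k + 1) = 0 := fun s x => hχ s x _ (by omega)
  have hz : ∀ s, ((φ.inv * φ.pow s) (tree i) : Laur).coeff (k + 1) = 0 := by
    intro s
    rw [he]
    cases i
    · rw [Character.inv_mul_t1]
      simp only [HahnSeries.coeff_sub, h1, sub_zero]
    · rw [Character.inv_mul_t2]
      simp only [HahnSeries.coeff_add, HahnSeries.coeff_sub, h1, hm, add_zero, sub_zero]
    · exact absurd rfl hi
  simp_rw [hz] at hd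
  exact hd.unique (hasDerivAt_const _ _)

theorem IsLaxFlow.tree_eq {n m : ℤ} {L : ℝ → InfChar Laur} (h : IsLaxFlow n m L) {i : RTree}
    (hi : i ≠ t4) (t : ℝ) : (L t).1 (tree i) = (L 0).1 (tree i) := by
  apply HahnSeries.ext
  ext k
  have hd : ∀ t, HasDerivAt (fun τ : ℝ => ((L τ).1 (tree i) : Laur).coeff k) 0 t := by
    intro t
    have := h t (tree i) k
    cases i
    · rwa [lie_t1] at this
    · rwa [lie_t2] at this
    · exact absurd rfl hi
  exact is_const_of_deriv_eq_zero (fun z => (hd z).differentiableAt) (fun z => (hd z).deriv) t 0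

/-- The value on the cherry of the right-hand side of the Lax equation. -/
def laxSlope (j : ℤ) (Z : InfChar Laur) : Laur :=
  2 * (Z.1 (tree t1) * rMatrix (HahnSeries.single j (1 : ℂ) * Z.1 (tree t2))
    - rMatrix (HahnSeries.single j (1 : ℂ) * Z.1 (tree t1)) * Z.1 (tree t2))

theorem eq_affine_of_hasDerivAt {f : ℝ → ℂ} {c : ℂ} (h : ∀ t, HasDerivAt f c t) (t : ℝ) :
    f t = t * c + f 0 := by
  have hd : ∀ t : ℝ, HasDerivAt (fun τ : ℝ => f τ - τ * c) 0 t := fun t =>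
    ((h t).sub ((hasDerivAt_id t).ofReal_comp.mul_const c)).congr_deriv (by simp)
  have := is_const_of_deriv_eq_zero (fun z => (hd z).differentiableAt) (fun z => (hd z).deriv) t 0
  simp only [Complex.ofReal_zero, zero_mul, sub_zero] at this
  rw [← this]
  ring

theorem IsLaxFlow.coeff_t4 {n m : ℤ} {L : ℝ → InfChar Laur} (h : IsLaxFlow n m L) (k : ℤ)
    (t : ℝ) : ((L t).1 (tree t4) : Laur).coeff k =
      t * (laxSlope (-n + 2 * m) (L 0)).coeff k + ((L 0).1 (tree t4) : Laur).coeff k := by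
  refine eq_affine_of_hasDerivAt (f := fun τ => ((L τ).1 (tree t4) : Laur).coeff k)
    (fun t => ?_) t
  have := h t (tree t4) k
  rw [lie_t4] at this
  refine this.congr_deriv (congrArg (fun f : Laur => f.coeff k) ?_)
  -- The slope involves only the conserved components, so it may be evaluated at time `0`.
  rw [laxSlope, ← h.tree_eq (i := t1) (by decide) t, ← h.tree_eq (i := t2) (by decide) t]
  rfl

theorem InfChar.coeff_apply (k : ℤ) (Z : InfChar Laur) (x : H1) :
    (InfChar.coeff k Z).1 x = (Z.1 x : Laur).coeff k := rfl

/-- The components of the flow `β̃₀`, `β̃_p`: those on `t1` and `t2` are constant, those on `t4`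
are affine, and the slope of `β̃₀` is that of `2 [β̃₀, β̃_p]`. -/
theorem IsBetaFlow.components {n m : ℤ} {φ : Character Laur} {L : ℝ → InfChar Laur}
    {φt : ℝ → Character Laur} {B : ℝ → InfChar Laur} (h : IsBetaFlow n m φ L φt B) :
    ∃ (u v : RTree → ℂ) (e : ℂ), ∀ t : ℝ,
      (InfChar.coeff 0 (B t)).1 (tree t1) = u t1 ∧
      (InfChar.coeff 0 (B t)).1 (tree t2) = u t2 ∧
      (InfChar.coeff 0 (B t)).1 (tree t4) = t * (4 * (u t1 * v t2 - v t1 * u t2)) + u t4 ∧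
      (InfChar.coeff (n - 2 * m + 1) (B t)).1 (tree t1) = v t1 ∧
      (InfChar.coeff (n - 2 * m + 1) (B t)).1 (tree t2) = v t2 ∧
      (InfChar.coeff (n - 2 * m + 1) (B t)).1 (tree t4) = t * e + v t4 := by
  have hB : ∀ t i k, (InfChar.coeff k (B t)).1 (tree i) =
      ((L t).1 (tree i) : Laur).coeff (k - 1) := by
    intro t i k
    rw [InfChar.coeff_apply, (h.beta t).coeff_tree, h.flow]
  have hp : ∀ i, i ≠ t4 → ∀ k < -1, ((L 0).1 (tree i) : Laur).coeff k = 0 := by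
    intro i hi k hk
    rw [h.init]
    exact h.isLocal.coeff_Rtilde hi hk
  refine ⟨fun i => ((L 0).1 (tree i) : Laur).coeff (-1),
    fun i => ((L 0).1 (tree i) : Laur).coeff (n - 2 * m),
    (laxSlope (-n + 2 * m) (L 0)).coeff (n - 2 * m), fun t => ?_⟩
  have e1 := h.lax.tree_eq (i := t1) (by decide) t
  have e2 := h.lax.tree_eq (i := t2) (by decide) t
  have e4 := fun k => h.lax.coeff_t4 k t
  have es := coeff_lax (hp t1 (by decide)) (hp t2 (by decide)) (n - 2 * m)
  refine ⟨?_, ?_, ?_, ?_, ?_, ?_⟩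
  · rw [hB, e1, zero_sub]
  · rw [hB, e2, zero_sub]
  · rw [hB, e4, zero_sub, laxSlope, show -n + 2 * m = -(n - 2 * m) by ring, es]
  · rw [hB, e1, add_sub_cancel_right]
  · rw [hB, e2, add_sub_cancel_right]
  · rw [hB, e4, add_sub_cancel_right]

end Flow

/-! ### The two Poisson brackets and their rank -/

section Poisson

theorem sum_RTree {M : Type*} [AddCommMonoid M] (f : RTree → M) :
    ∑ i, f i = f t1 + f t2 + f t4 := by
  have e : (Finset.univ : Finset RTree) = {t1, t2, t4} := rfl
  rw [e, Finset.sum_insert (by decide), Finset.sum_insert (by decide), Finset.sum_singleton,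
    add_assoc]

theorem g1_lie_basisG_t1 (Z : g1) : ⁅Z, basisG t1⁆ = (-2 * Z.1 (tree t2)) • basisG t4 := by
  apply g1_ext
  intro i
  change _ = (-2 * Z.1 (tree t2)) * (basisG t4).1 (tree i)
  cases i <;> simp [-LieSubalgebra.coe_bracket, lie_t1, lie_t2, lie_t4, basisG_tree]

theorem g1_lie_basisG_t2 (Z : g1) : ⁅Z, basisG t2⁆ = (2 * Z.1 (tree t1)) • basisG t4 := by
  apply g1_ext
  intro i
  change _ = (2 * Z.1 (tree t1)) * (basisG t4).1 (tree i)
  cases i <;> simp [-LieSubalgebra.coe_bracket, lie_t1, lie_t2, lie_t4, basisG_tree]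

theorem g1_lie_basisG_t4 (Z : g1) : ⁅Z, basisG t4⁆ = 0 := by
  apply g1_ext
  intro i
  change _ = (0 : ℂ)
  cases i <;> simp [-LieSubalgebra.coe_bracket, lie_t1, lie_t2, lie_t4, basisG_tree]

theorem coords_lie (x y : Delta1) : coords ⁅x, y⁆ = Sum.elim
    (fun
      | t1 => 0
      | t2 => 0
      | t4 => 2 * (coords x (.inl t1) * coords y (.inl t2)
          - coords y (.inl t1) * coords x (.inl t2)))
    (fun
      | t1 => 2 * (coords x (.inl t2) * coords y (.inr t4)
          - coords y (.inl t2) * coords x (.inr t4))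
      | t2 => 2 * (coords y (.inl t1) * coords x (.inr t4)
          - coords x (.inl t1) * coords y (.inr t4))
      | t4 => 0) := by
  ext a
  rcases a with i | i
  · cases i <;> simp [-LieSubalgebra.coe_bracket, coords, lie_t1, lie_t2, lie_t4]
  · cases i <;> simp [coords, g1_lie_basisG_t1, g1_lie_basisG_t2, g1_lie_basisG_t4] <;> ring

theorem coords_basisD (a b : Idx) : coords (basisD a) b = if a = b then 1 else 0 := by
  rcases a with i | i <;> rcases b with j | j <;>
    simp [coords, basisD, basisG_tree]
  exact (basisG_tree j i).trans (if_congr eq_comm rfl rfl)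

theorem bracketOf_coordBracket (f g : Poly) : bracketOf coordBracket f g =
    2 * (cs t4 * (MvPolynomial.pderiv (.inl t1) f * MvPolynomial.pderiv (.inl t2) g
          - MvPolynomial.pderiv (.inl t2) f * MvPolynomial.pderiv (.inl t1) g)
      + cx t2 * (MvPolynomial.pderiv (.inr t4) f * MvPolynomial.pderiv (.inl t1) g
          - MvPolynomial.pderiv (.inl t1) f * MvPolynomial.pderiv (.inr t4) g)
      + cx t1 * (MvPolynomial.pderiv (.inl t2) f * MvPolynomial.pderiv (.inr t4) g
          - MvPolynomial.pderiv (.inr t4) f * MvPolynomial.pderiv (.inl t2) g)) := by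
  have e : (MvPolynomial.C 2 : Poly) = 2 := map_ofNat MvPolynomial.C 2
  simp [bracketOf, coordBracket, e, pairingPoly, sum_RTree, coords_lie, coords_basisD]
  ring

theorem bracketOf_lieBracket (f g : Poly) : bracketOf lieBracket f g =
    2 * (cs t4 * (MvPolynomial.pderiv (.inr t1) f * MvPolynomial.pderiv (.inr t2) g
          - MvPolynomial.pderiv (.inr t2) f * MvPolynomial.pderiv (.inr t1) g)
      + cx t2 * (MvPolynomial.pderiv (.inl t4) f * MvPolynomial.pderiv (.inr t1) g
          - MvPolynomial.pderiv (.inr t1) f * MvPolynomial.pderiv (.inl t4) g)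
      + cx t1 * (MvPolynomial.pderiv (.inr t2) f * MvPolynomial.pderiv (.inl t4) g
          - MvPolynomial.pderiv (.inl t4) f * MvPolynomial.pderiv (.inr t2) g)) := by
  have e : (MvPolynomial.C 2 : Poly) = 2 := map_ofNat MvPolynomial.C 2
  simp [bracketOf, lieBracket, e, pairingPoly, sum_RTree, coords_lie, coords_basisD]
  ring

theorem bracketOf_swap {W : Idx → Idx → Poly} (h : ∀ a b, W a b = -W b a) (f g : Poly) :
    bracketOf W f g = -bracketOf W g f := by
  rw [bracketOf, bracketOf, Finset.sum_comm, ← Finset.sum_neg_distrib]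
  refine Finset.sum_congr rfl fun a _ => ?_
  rw [← Finset.sum_neg_distrib]
  refine Finset.sum_congr rfl fun b _ => ?_
  rw [h b a]
  ring

theorem bracketOf_mul (W : Idx → Idx → Poly) (f g h : Poly) :
    bracketOf W f (g * h) = bracketOf W f g * h + g * bracketOf W f h := by
  simp only [bracketOf, Finset.sum_mul, Finset.mul_sum, ← Finset.sum_add_distrib]
  refine Finset.sum_congr rfl fun a _ => Finset.sum_congr rfl fun b _ => ?_
  rw [Derivation.leibniz, smul_eq_mul, smul_eq_mul]
  ring

/-- The commutator is a derivation, and it vanishes on the variables. -/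
theorem pderiv_comm (a b : Idx) (f : Poly) : MvPolynomial.pderiv a (MvPolynomial.pderiv b f) =
    MvPolynomial.pderiv b (MvPolynomial.pderiv a f) := by
  have e : ⁅(MvPolynomial.pderiv a : Derivation ℂ Poly Poly),
      (MvPolynomial.pderiv b : Derivation ℂ Poly Poly)⁆ = 0 := by
    apply MvPolynomial.derivation_ext
    intro i
    simp only [Derivation.commutator_apply, MvPolynomial.pderiv_X, Derivation.zero_apply]
    classical
    simp [Pi.single_apply, apply_ite]
  have := congrArg (fun D : Derivation ℂ Poly Poly => D f) e
  rwa [Derivation.commutator_apply, Derivation.zero_apply, sub_eq_zero] at this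

/-- The Jacobi identity for the bracket `w · (∇f × ∇g)` of three commuting derivations and a
vector `w` with `D_i w_j = c δ_ij`. -/
theorem jacobi_of_commuting_derivations {A : Type*} [CommRing A] [Algebra ℂ A]
    (D₁ D₂ D₃ : Derivation ℂ A A) (h₁₂ : ∀ f, D₁ (D₂ f) = D₂ (D₁ f))
    (h₁₃ : ∀ f, D₁ (D₃ f) = D₃ (D₁ f)) (h₂₃ : ∀ f, D₂ (D₃ f) = D₃ (D₂ f)) (p q r c : A)
    (hp : D₁ p = c ∧ D₂ p = 0 ∧ D₃ p = 0) (hq : D₁ q = 0 ∧ D₂ q = c ∧ D₃ q = 0)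
    (hr : D₁ r = 0 ∧ D₂ r = 0 ∧ D₃ r = c) (β : A → A → A)
    (hβ : ∀ f g, β f g = 2 * (r * (D₁ f * D₂ g - D₂ f * D₁ g)
      + q * (D₃ f * D₁ g - D₁ f * D₃ g) + p * (D₂ f * D₃ g - D₃ f * D₂ g))) (f g h : A) :
    β f (β g h) + β g (β h f) + β h (β f g) = 0 := by
  have h2 : ∀ D : Derivation ℂ A A, D 2 = 0 := fun D => by exact_mod_cast D.map_natCast 2
  simp only [hβ, Derivation.leibniz, map_add, map_sub, smul_eq_mul, h2, hp, hq, hr, h₁₂, h₁₃,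
    h₂₃]
  ring

theorem skew_coordBracket (a b : Idx) : coordBracket a b = -coordBracket b a := by
  rw [coordBracket, coordBracket, pairingPoly, pairingPoly]
  simp [coords_lie, sum_RTree]
  ring

theorem isPoisson_coordBracket : IsPoisson coordBracket where
  skew := bracketOf_swap skew_coordBracket
  leibniz := bracketOf_mul _
  jacobi f g h := by
    have h₁ : ∀ i a : Idx, MvPolynomial.pderiv i (MvPolynomial.X a : Poly) =
        if a = i then 1 else 0 := fun i a => by
      rw [MvPolynomial.pderiv_X, Pi.single_apply]
    -- Here `c = 1`: the vector `w` consists of the very coordinates being differentiated.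
    refine jacobi_of_commuting_derivations (A := Poly) (MvPolynomial.pderiv (.inl t1))
      (MvPolynomial.pderiv (.inl t2)) (MvPolynomial.pderiv (.inr t4)) (pderiv_comm _ _)
      (pderiv_comm _ _) (pderiv_comm _ _) (cx t1) (cx t2) (cs t4) 1 ?_ ?_ ?_
      (bracketOf coordBracket) bracketOf_coordBracket f g h
    all_goals simp [h₁]

theorem skew_lieBracket (a b : Idx) : lieBracket a b = -lieBracket b a := by
  rw [lieBracket, lieBracket, pairingPoly, pairingPoly]
  simp [coords_lie, sum_RTree]
  ring

theorem isPoisson_lieBracket : IsPoisson lieBracket where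
  skew := bracketOf_swap skew_lieBracket
  leibniz := bracketOf_mul _
  jacobi f g h := by
    have h₁ : ∀ i a : Idx, MvPolynomial.pderiv i (MvPolynomial.X a : Poly) =
        if a = i then 1 else 0 := fun i a => by
      rw [MvPolynomial.pderiv_X, Pi.single_apply]
    -- Here `c = 0`: the entries of `w` are constant in the active directions.
    refine jacobi_of_commuting_derivations (A := Poly) (MvPolynomial.pderiv (.inr t1))
      (MvPolynomial.pderiv (.inr t2)) (MvPolynomial.pderiv (.inl t4)) (pderiv_comm _ _)
      (pderiv_comm _ _) (pderiv_comm _ _) (cx t1) (cx t2) (cs t4) 0 ?_ ?_ ?_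
      (bracketOf lieBracket) bracketOf_lieBracket f g h
    all_goals simp [h₁]

/-- The coordinates as a linear map. -/
def coordsLin : Delta1 →ₗ[ℂ] (Idx → ℂ) where
  toFun := coords
  map_add' x z := by ext a; rcases a with i | i <;> rfl
  map_smul' c x := by ext a; rcases a with i | i <;> rfl

theorem coords_sum_basisD (y : Idx → ℂ) : coords (∑ a, y a • basisD a) = y := by
  change coordsLin _ = y
  ext b
  rw [map_sum]
  simp only [map_smul, Finset.sum_apply, Pi.smul_apply, smul_eq_mul]
  change ∑ a, y a * coords (basisD a) b = y b
  simp [coords_basisD]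

theorem coords_surjective : Function.Surjective coords := fun y => ⟨_, coords_sum_basisD y⟩

theorem coords_grad (f : Poly) (x : Delta1) : coords (grad f x) = diff f x :=
  coords_sum_basisD _

/-- A skew-symmetric matrix of odd size is singular. -/
theorem cross_matrix_rank_le (a b c : ℂ) :
    (!![0, c, -b; -c, 0, a; b, -a, 0] : Matrix (Fin 3) (Fin 3) ℂ).rank ≤ 2 := by
  set M : Matrix (Fin 3) (Fin 3) ℂ := !![0, c, -b; -c, 0, a; b, -a, 0]
  have h3 : M.rank ≤ 3 := M.rank_le_height
  by_contra h
  have h' : M.rank = 3 := by omega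
  have hs : Function.Surjective M.mulVec := by
    rw [← Matrix.coe_mulVecLin, ← LinearMap.range_eq_top]
    apply Submodule.eq_top_of_finrank_eq
    rw [Module.finrank_fin_fun]
    exact h'
  have hu := Matrix.mulVec_surjective_iff_isUnit.1 hs
  rw [Matrix.isUnit_iff_isUnit_det, isUnit_iff_ne_zero] at hu
  apply hu
  simp [M, Matrix.det_fin_three]
  ring

/-- The three coordinates on which the coordinate bracket is nonzero. -/
def activeIdx : Fin 3 → Idx := ![.inl t1, .inl t2, .inr t4]

theorem hasRank_coordBracket : HasRank coordBracket 2 := by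
  let T : Delta1 → Matrix (Fin 3) (Fin 3) ℂ := fun x =>
    !![0, 2 * coords x (.inr t4), -(2 * coords x (.inl t2));
      -(2 * coords x (.inr t4)), 0, 2 * coords x (.inl t1);
      2 * coords x (.inl t2), -(2 * coords x (.inl t1)), 0]
  let E : Matrix Idx (Fin 3) ℂ := Matrix.of fun a i => if a = activeIdx i then 1 else 0
  -- The Poisson tensor is the skew `3 × 3` block `T x` on the active coordinates, extended by zero.
  have hE : ∀ x, (Matrix.of fun a b => value (coordBracket a b) x) = E * T x * E.transpose := by
    intro x
    ext a b
    rw [Matrix.mul_apply]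
    simp only [Matrix.mul_apply, Fin.sum_univ_three, Matrix.of_apply, coordBracket, value,
      pairingPoly, Fintype.sum_sum_type, sum_RTree, coords_lie, coords_basisD, E, T, activeIdx,
      Matrix.transpose_apply]
    rcases a with a | a <;> rcases b with b | b <;> cases a <;> cases b <;> simp
  refine ⟨fun x => ?_, ?_⟩
  · rw [hE]
    exact ((Matrix.rank_mul_le_left _ _).trans (Matrix.rank_mul_le_right _ _)).trans
      (cross_matrix_rank_le _ _ _)
  · obtain ⟨x, hx⟩ := coords_surjective fun _ => 1
    refine ⟨x, le_antisymm ?_ ?_⟩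
    · rw [hE]
      exact ((Matrix.rank_mul_le_left _ _).trans (Matrix.rank_mul_le_right _ _)).trans
        (cross_matrix_rank_le _ _ _)
    · have h := Matrix.rank_submatrix_le (Matrix.of fun a b => value (coordBracket a b) x)
        ![.inl t1, .inl t2] ![.inl t1, .inl t2]
      refine le_trans ?_ h
      have e : (Matrix.of fun a b => value (coordBracket a b) x).submatrix
          ![Sum.inl t1, Sum.inl t2] ![Sum.inl t1, Sum.inl t2] = !![0, 2; -2, 0] := by
        ext i j
        fin_cases i <;> fin_cases j <;>
          simp [coordBracket, value, pairingPoly, sum_RTree, coords_lie, coords_basisD, hx]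
      rw [e, Matrix.rank_of_isUnit _ ((Matrix.isUnit_iff_isUnit_det _).2
        (isUnit_iff_ne_zero.2 (by simp)))]
      simp

theorem hasRank_lieBracket : HasRank lieBracket 2 := by
  -- The two Poisson tensors differ by the relabelling `x_i ↔ x_i*` of rows and columns, which
  -- preserves the rank.
  have e : ∀ x, (Matrix.of fun a b => value (lieBracket a b) x) =
      (Matrix.of fun a b => value (coordBracket a b) x).submatrix
        (Equiv.sumComm RTree RTree) (Equiv.sumComm RTree RTree) := fun x => rfl
  have h := hasRank_coordBracket
  refine ⟨fun x => ?_, ?_⟩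
  · rw [e, Matrix.rank_submatrix]
    exact h.1 x
  · obtain ⟨x, hx⟩ := h.2
    exact ⟨x, by rw [e, Matrix.rank_submatrix, hx]⟩

end Poisson

/-! ### Involution, generic independence, Hamiltonian curves -/

section Integrability

theorem dense_value_ne_zero {p : Poly} (hp : p ≠ 0) :
    IsOpen {x | value p x ≠ 0} ∧ Dense {x | value p x ≠ 0} := by
  have hc : Continuous coords := continuous_induced_dom
  refine ⟨isOpen_ne.preimage ((MvPolynomial.continuous_eval p).comp hc), fun x => ?_⟩
  rw [mem_closure_iff]
  rintro O hO hx
  obtain ⟨V, hV, rfl⟩ := isOpen_induced_iff.1 hO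
  obtain ⟨u, hu, huV⟩ := isOpen_pi_iff'.1 hV _ hx
  by_contra hne
  -- A neighbourhood contains a box with infinite sides, on which a nonzero polynomial cannot vanish
  -- identically.
  refine hp (MvPolynomial.funext_set u
    (fun a => infinite_of_mem_nhds _ ((hu a).1.mem_nhds (hu a).2)) fun y hy => ?_)
  obtain ⟨z, rfl⟩ := coords_surjective y
  rw [map_zero]
  by_contra h
  exact hne ⟨z, huV hy, h⟩

theorem independentOnOpenDense_of_value_ne_zero {ι : Type} {F : ι → Poly} {p : Poly}
    (y : Idx → ℂ) (hy : MvPolynomial.eval y p ≠ 0)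
    (h : ∀ x, value p x ≠ 0 → LinearIndependent ℂ fun i => diff (F i) x) :
    IndependentOnOpenDense F := by
  have hp : p ≠ 0 := by
    rintro rfl
    exact hy (map_zero _)
  exact ⟨_, (dense_value_ne_zero hp).1, (dense_value_ne_zero hp).2, h⟩

theorem inInvolution_familyH (k l : RTree → ℂ) : InInvolution coordBracket (familyH k l) := by
  intro i j
  rw [bracketOf_coordBracket]
  fin_cases i <;> fin_cases j <;>
    simp [familyH, quadH, sum_RTree] <;> ring

theorem inInvolution_familyL (k l : RTree → ℂ) : InInvolution lieBracket (familyL k l) := by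
  intro i j
  rw [bracketOf_lieBracket]
  fin_cases i <;> fin_cases j <;>
    simp [familyL, liftH, sum_RTree] <;> ring

theorem diff_quadH (k l : RTree → ℂ) (x : Delta1) : diff (quadH k l) x =
    Sum.elim (fun i => k i + l i * coords x (.inl i)) 0 := by
  ext a
  rcases a with i | i <;> cases i <;>
    simp [diff, value, quadH, sum_RTree] <;> ring

theorem diff_liftH (k l : RTree → ℂ) (x : Delta1) : diff (liftH k l) x =
    Sum.elim (fun i => l i * coords x (.inr i)) (fun i => k i + l i * coords x (.inl i)) := by
  ext a
  rcases a with i | i <;> cases i <;>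
    simp [diff, value, liftH, sum_RTree] <;> ring

theorem independentOnOpenDense_familyH {k l : RTree → ℂ} (hl : l t1 = 1) :
    IndependentOnOpenDense (familyH k l) := by
  refine independentOnOpenDense_of_value_ne_zero
    -- The factors are the pivots of a triangular elimination; the last is `∂H/∂x₁`, where `l₁ = 1`
    -- is used. At the test point every factor equals `1`.
    (p := cx t4 * cs t1 * cs t2 * cs t4 * (MvPolynomial.C (k t1) + cx t1))
    (fun a => if a = .inl t1 then 1 - k t1 else 1) (by simp) fun x hx => ?_
  simp only [value, map_mul, map_add, MvPolynomial.eval_X, MvPolynomial.eval_C, mul_ne_zero_iff]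
    at hx
  obtain ⟨⟨⟨⟨h1, h2⟩, h3⟩, h4⟩, h5⟩ := hx
  rw [Fintype.linearIndependent_iff]
  intro c hc
  have e := fun a => congrFun hc a
  simp only [Finset.sum_apply, Fin.sum_univ_five, Pi.smul_apply, smul_eq_mul] at e
  have c4 : c 4 = 0 := by
    simpa [familyH, quadH, diff, value, sum_RTree, h4] using e (.inr t4)
  have c3 : c 3 = 0 := by
    simpa [familyH, quadH, diff, value, sum_RTree, h3] using e (.inr t2)
  have c2 : c 2 = 0 := by
    simpa [familyH, quadH, diff, value, sum_RTree, h2] using e (.inr t1)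
  have c0 : c 0 = 0 := by
    have := e (.inl t1)
    simpa [familyH, quadH, diff, value, sum_RTree, hl, c4, h5] using this
  have c1 : c 1 = 0 := by
    simpa [familyH, quadH, diff, value, sum_RTree, c0, c4, h1] using e (.inl t4)
  intro i
  fin_cases i <;> assumption

theorem independentOnOpenDense_familyL {k l : RTree → ℂ} (hl1 : l t1 = 1) (hl2 : l t2 = 0) :
    IndependentOnOpenDense (familyL k l) := by
  refine independentOnOpenDense_of_value_ne_zero
    -- This is the minor of the differentials of `Ĥ` and `⟨x, x⟩/2` in the directions `x₁*, x₂*`.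
    -- Its term `x₁x₂` survives because `l₁ ≠ l₂`, and its value at the test point is `1`.
    (p := (MvPolynomial.C (k t1) + cx t1) * cx t2 - MvPolynomial.C (k t2) * cx t1)
    (fun a => if a = .inl t1 then 1 - k t1 else 1 + k t2 * (1 - k t1)) (by simp) fun x hx => ?_
  simp only [value, map_mul, map_add, map_sub, MvPolynomial.eval_X, MvPolynomial.eval_C] at hx
  rw [Fintype.linearIndependent_iff]
  intro c hc
  have e := fun a => congrFun hc a
  simp only [Finset.sum_apply, Fin.sum_univ_five, Pi.smul_apply, smul_eq_mul] at e
  have e1 : c 0 * (k t1 + coords x (.inl t1)) + c 4 * coords x (.inl t1) = 0 := by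
    simpa [familyL, liftH, diff, value, sum_RTree, hl1, hl2] using e (.inr t1)
  have e2 : c 0 * k t2 + c 4 * coords x (.inl t2) = 0 := by
    simpa [familyL, liftH, diff, value, sum_RTree, hl1, hl2] using e (.inr t2)
  have c0 : c 0 = 0 := by
    refine (mul_eq_zero.1 ?_).resolve_right hx
    linear_combination coords x (.inl t2) * e1 - coords x (.inl t1) * e2
  have c4 : c 4 = 0 := by
    refine (mul_eq_zero.1 ?_).resolve_right hx
    linear_combination (k t1 + coords x (.inl t1)) * e2 - k t2 * e1
  have c1 : c 1 = 0 := by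
    simpa [familyL, liftH, diff, value, sum_RTree, c0, c4] using e (.inl t1)
  have c2 : c 2 = 0 := by
    simpa [familyL, liftH, diff, value, sum_RTree, c0, c4] using e (.inl t2)
  have c3 : c 3 = 0 := by
    simpa [familyL, liftH, diff, value, sum_RTree, c0, c4] using e (.inr t4)
  intro i
  fin_cases i <;> assumption

theorem hasDerivAt_value {γ : ℝ → Delta1} {v : Delta1} {t : ℝ} (h : HasVelocity γ v t)
    (f : Poly) :
    HasDerivAt (fun τ => value f (γ τ)) (∑ a, diff f (γ t) a * coords v a) t := by
  induction f using MvPolynomial.induction_on with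
  | C c => simpa [value, diff] using hasDerivAt_const t c
  | add p q hp hq =>
    simp only [value, map_add]
    refine (hp.add hq).congr_deriv ?_
    simp only [diff, map_add, value, add_mul, Finset.sum_add_distrib]
  | mul_X p a hp =>
    simp only [value, map_mul, MvPolynomial.eval_X]
    refine (hp.mul (h a)).congr_deriv ?_
    have e : ∀ b, diff (p * MvPolynomial.X a) (γ t) b * coords v b =
        (if b = a then value p (γ t) * coords v b else 0) +
          diff p (γ t) b * coords v b * coords (γ t) a := by
      intro b
      simp only [diff, value, Derivation.leibniz, MvPolynomial.pderiv_X, Pi.single_apply,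
        smul_eq_mul, map_add, map_mul, MvPolynomial.eval_X, apply_ite (MvPolynomial.eval _),
        map_one, map_zero, eq_comm (a := a)]
      split_ifs <;> ring
    rw [Finset.sum_congr rfl fun b _ => e b, Finset.sum_add_distrib, Finset.sum_ite_eq',
      if_pos (Finset.mem_univ a), ← Finset.sum_mul]
    exact add_comm _ _

theorem linearIndependent_basisG : LinearIndependent ℂ basisG := by
  rw [Fintype.linearIndependent_iff]
  intro c hc i
  have := congrArg (dualBasisG i) hc
  have e : ∀ j, dualBasisG i (basisG j) = if j = i then 1 else 0 := fun j => basisG_tree j i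
  simpa [e] using this

theorem span_range_basisG : Submodule.span ℂ (Set.range basisG) = ⊤ := by
  refine eq_top_iff.2 fun Z _ => ?_
  rw [eq_sum_basisG Z]
  exact Submodule.sum_mem _ fun i _ => Submodule.smul_mem _ _ (Submodule.subset_span ⟨i, rfl⟩)

theorem coords_injective : Function.Injective coords := by
  intro x y h
  have h1 : x.vec = y.vec := g1_ext fun i => congrFun h (.inl i)
  refine Delta1.ext h1 (LinearMap.ext fun Z => ?_)
  rw [eq_sum_basisG Z, map_sum, map_sum]
  refine Finset.sum_congr rfl fun i _ => ?_
  rw [map_smul, map_smul]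
  exact congrArg _ (congrFun h (.inr i))

theorem coords_ofG (Z : g1) : coords (ofG Z) = Sum.elim (fun i => Z.1 (tree i)) 0 := by
  ext a
  rcases a with i | i <;> rfl

theorem exists_g1 (f : RTree → ℂ) : ∃ Z : g1, ∀ i, Z.1 (tree i) = f i := by
  refine ⟨∑ i, f i • basisG i, fun j => ?_⟩
  change dualBasisG j (∑ i, f i • basisG i) = _
  have e : ∀ i, dualBasisG j (basisG i) = if i = j then 1 else 0 := fun i => basisG_tree i j
  simp [e]

/-- In the subspace `𝔤₁` the equation with the gradient of `quadH k l` is Hamiltonian for the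
Lie-Poisson bracket, with Hamiltonian function `-2 * liftH k l`. -/
theorem isHamiltonianCurve_liftH {k l : RTree → ℂ} {β : ℝ → g1}
    (h : ∀ t, HasVelocity (fun τ => ofG (β τ))
      ((2 : ℂ) • ⁅ofG (β t), grad (quadH k l) (ofG (β t))⁆) t) :
    IsHamiltonianCurve lieBracket (-2 * liftH k l) fun t => ofG (β t) := by
  intro f t
  refine (hasDerivAt_value (h t) f).congr_deriv ?_
  have e : ∀ (y z : Delta1) a, coords ((2 : ℂ) • ⁅y, z⁆) a = 2 * coords ⁅y, z⁆ a :=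
    fun y z a => congrFun (coordsLin.map_smul 2 ⁅y, z⁆) a
  have hd : ∀ a x, MvPolynomial.eval (coords x) (MvPolynomial.pderiv a (-2 * liftH k l)) =
      -2 * diff (liftH k l) x a := by
    intro a x
    have h2 : (-2 * liftH k l : Poly) = MvPolynomial.C (-2) * liftH k l := by
      rw [map_neg, map_ofNat]
    rw [h2, diff, MvPolynomial.pderiv_C_mul, map_mul, MvPolynomial.eval_C, value]
  rw [bracketOf_lieBracket, value]
  simp only [map_mul, map_add, map_sub,
    MvPolynomial.eval_X, map_ofNat, hd]
  -- On `𝔤₁` all `x_i*` vanish, so the `x_i`-derivatives of `Ĥ` drop out and its `x_i*`-derivatives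
  -- are the `x_i`-derivatives of `H`.
  simp only [diff_liftH, e, coords_lie, coords_grad, diff_quadH, Fintype.sum_sum_type, sum_RTree,
    coords_ofG, Sum.elim_inl, Sum.elim_inr, Pi.zero_apply]
  simp only [diff, value, coords_ofG]
  ring

end Integrability

/-- On the cherry, `t * e + v t4` has to be an affine function of `t * d + u t4`. This forces slope
`e / d` if `d ≠ 0`; if `d = 0`, it requires `e = 0`, and the convention `e / 0 = 0` gives the right
constants. The conditions on `t1` and `t2` hold in every case, and only they enter the bracket. -/
theorem exists_hamiltonian_constants (u v : RTree → ℂ) (d e : ℂ) : ∃ k l : RTree → ℂ,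
    l t1 = 1 ∧ l t2 = 0 ∧ k t1 + u t1 = v t1 ∧ k t2 = v t2 ∧
      ((d = 0 → e = 0) → ∀ t : ℂ, k t4 + l t4 * (t * d + u t4) = t * e + v t4) := by
  refine ⟨fun | t1 => v t1 - u t1 | t2 => v t2 | t4 => v t4 - e / d * u t4,
    fun | t1 => 1 | t2 => 0 | t4 => e / d, rfl, rfl, by simp, rfl, fun h t => ?_⟩
  by_cases hd : d = 0
  · simp [hd, h hd]
  · field_simp
    ring

end RootedTreeFlow

end

open RootedTreeFlow RootedTreeFlow.RTree in
theorem mainTheorem1 :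
    -- `𝔤₁` is the three-dimensional Heisenberg algebra
    (LinearIndependent ℂ basisG ∧ Submodule.span ℂ (Set.range basisG) = ⊤ ∧
      ⁅basisG t1, basisG t2⁆ = (2 : ℂ) • basisG t4 ∧
      ⁅basisG t1, basisG t4⁆ = 0 ∧ ⁅basisG t2, basisG t4⁆ = 0) ∧
    -- both brackets are Poisson brackets of rank two on `δ₁`
    (IsPoisson coordBracket ∧ HasRank coordBracket 2) ∧
    (IsPoisson lieBracket ∧ HasRank lieBracket 2) ∧
    -- integrability of the flow
    ∀ (n m : ℤ) (φ : Character Laur) (L : ℝ → InfChar Laur) (φt : ℝ → Character Laur)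
      (B : ℝ → InfChar Laur), -n + 2 * m ≤ 0 → IsBetaFlow n m φ L φt B →
      ∀ β₀ βp : ℝ → g1, (β₀ = fun t => InfChar.coeff 0 (B t)) →
        (βp = fun t => InfChar.coeff (n - 2 * m + 1) (B t)) →
      -- the equation
      (∀ t, HasVelocity (fun τ => Delta1.ofG (β₀ τ)) (Delta1.ofG ((2 : ℂ) • ⁅β₀ t, βp t⁆)) t) ∧
      -- both curves are affine
      (∃ a b c d : g1, ∀ t : ℝ, β₀ t = (t : ℂ) • a + b ∧ βp t = (t : ℂ) • c + d) ∧
      ∃ k l : RTree → ℂ,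
        -- `H` is a Hamiltonian function of the equation in gradient form
        (((∀ t, β₀ t = β₀ 0) → ∀ t, βp t = βp 0) →
          ∀ t, Delta1.ofG (βp t) = grad (quadH k l) (Delta1.ofG (β₀ t))) ∧
        (∀ t, HasVelocity (fun τ => Delta1.ofG (β₀ τ))
          ((2 : ℂ) • ⁅Delta1.ofG (β₀ t), grad (quadH k l) (Delta1.ofG (β₀ t))⁆) t) ∧
        -- `H, H₂, H₃, H₄, H₅`
        InInvolution coordBracket (familyH k l) ∧ IndependentOnOpenDense (familyH k l) ∧
        -- complete integrability for the Lie-Poisson bracket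
        IsHamiltonianCurve lieBracket (-2 * liftH k l) (fun t => Delta1.ofG (β₀ t)) ∧
        InInvolution lieBracket (familyL k l) ∧ IndependentOnOpenDense (familyL k l) := by
  refine ⟨⟨linearIndependent_basisG, span_range_basisG, ?_, g1_lie_basisG_t4 _,
    g1_lie_basisG_t4 _⟩, ⟨isPoisson_coordBracket, hasRank_coordBracket⟩,
    ⟨isPoisson_lieBracket, hasRank_lieBracket⟩, ?_⟩
  · rw [g1_lie_basisG_t2, basisG_tree, if_pos rfl, mul_one]
  intro n m φ L φt B _ hflow β₀ βp hβ₀ hβp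
  obtain ⟨u, v, e, huv⟩ := hflow.components
  have hu : ∀ t i, (β₀ t).1 (tree i) =
      if i = t4 then t * (4 * (u t1 * v t2 - v t1 * u t2)) + u t4 else u i := by
    intro t i
    subst hβ₀
    obtain ⟨h1, h2, h4, -⟩ := huv t
    cases i
    exacts [h1, h2, h4]
  have hv : ∀ t i, (βp t).1 (tree i) = if i = t4 then t * e + v t4 else v i := by
    intro t i
    subst hβp
    obtain ⟨-, -, -, h1, h2, h4⟩ := huv t
    cases i
    exacts [h1, h2, h4]
  clear huv hβ₀ hβp hflow
  set d := 4 * (u t1 * v t2 - v t1 * u t2) with hd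
  -- The velocity of `β̃₀` is always `d X₃`, so both forms of the equation reduce to computing the
  -- coordinates of their right-hand sides.
  have hvel : ∀ (t : ℝ) (w : Delta1), coords w = Sum.elim (fun i => if i = t4 then d else 0) 0 →
      HasVelocity (fun τ => Delta1.ofG (β₀ τ)) w t := by
    intro t w hw a
    simp only [coords_ofG, hw]
    rcases a with i | i
    · simp only [Sum.elim_inl, hu]
      cases i
      · exact hasDerivAt_const _ _
      · exact hasDerivAt_const _ _
      · refine ((((hasDerivAt_id t).ofReal_comp).mul_const d).add_const (u t4)).congr_deriv ?_
        simp
    · exact hasDerivAt_const _ _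
  have h2 : ∀ (y : Delta1), coords ((2 : ℂ) • y) = (2 : ℂ) • coords y :=
    fun y => coordsLin.map_smul 2 y
  refine ⟨fun t => hvel t _ ?_, ?_, ?_⟩
  · ext a
    rw [coords_ofG]
    rcases a with i | i
    · change 2 * ⁅β₀ t, βp t⁆.1 (tree i) = _
      cases i
      · simp [-LieSubalgebra.coe_bracket, lie_t1]
      · simp [-LieSubalgebra.coe_bracket, lie_t2]
      · rw [lie_t4]
        simp [hu, hv, hd]
        ring
    · rfl
  · obtain ⟨a, ha⟩ := exists_g1 fun i => if i = t4 then d else 0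
    obtain ⟨b, hb⟩ := exists_g1 u
    obtain ⟨c, hc⟩ := exists_g1 fun i => if i = t4 then e else 0
    obtain ⟨f, hf⟩ := exists_g1 v
    refine ⟨a, b, c, f, fun t => ⟨g1_ext fun i => ?_, g1_ext fun i => ?_⟩⟩
    · change _ = (t : ℂ) * a.1 (tree i) + b.1 (tree i)
      rw [hu, ha, hb]
      cases i <;> simp
    · change _ = (t : ℂ) * c.1 (tree i) + f.1 (tree i)
      rw [hv, hc, hf]
      cases i <;> simp
  · obtain ⟨k, l, hl1, hl2, hk1, hk2, hk4⟩ := exists_hamiltonian_constants u v d e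
    have hham : ∀ t, HasVelocity (fun τ => Delta1.ofG (β₀ τ))
        ((2 : ℂ) • ⁅Delta1.ofG (β₀ t), grad (quadH k l) (Delta1.ofG (β₀ t))⁆) t := by
      refine fun t => hvel t _ ?_
      rw [h2, coords_lie, coords_grad, diff_quadH, coords_ofG]
      ext a
      rcases a with i | i <;> cases i <;> simp [hu, hl1, hl2, hk1, hk2, hd]
      ring
    refine ⟨k, l, fun hconst t => coords_injective ?_, hham, inInvolution_familyH k l,
      independentOnOpenDense_familyH hl1, isHamiltonianCurve_liftH hham,
      inInvolution_familyL k l, independentOnOpenDense_familyL hl1 hl2⟩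
    -- If `d = 0` then `β̃₀` is constant, so `β̃_p` is constant by assumption; comparing times `1`
    -- and `0` gives `e = 0`.
    have hde : d = 0 → e = 0 := by
      intro h0
      have hb : ∀ t, β₀ t = β₀ 0 := fun t => g1_ext fun i => by simp [hu, h0]
      have h1 := congrArg (fun Z : g1 => Z.1 (tree t4)) (hconst hb 1)
      simpa [hv] using h1
    rw [coords_grad, diff_quadH, coords_ofG, coords_ofG]
    ext a
    rcases a with i | i
    · cases i
      · simp [hu, hv, hl1, hk1]
      · simp [hv, hl2, hk2]
      · simpa [hu, hv] using (hk4 hde t).symm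
    · rfl
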